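/- Let $I$ be a set and let $\mathcal F$ be a family of finite subsets of $I$. For an infinite $J\subseteq I$, $\mathcal F$ is *large* in $J$ if for every $n\in\mathbb N$ and every infinite $K\subseteq J$ there is $s\in\mathcal F$ with $\#(s\cap K)\ge n$; $\mathcal F$ is *pre-compact* if its closure in $2^I$ (product topology) consists of finite sets only. $\mathcal F$ is a *$T$-family* on $I$ if it is pre-compact and there is a partition $I=\bigcup_{n\in\mathbb N}I_n$ into nonempty finite sets such that (a) $\mathcal F$ is not large in any infinite $J\subseteq I$, and (b) for some $0<\lambda\le 1$ the family $\{\{n\in\mathbb N:\#(s\cap I_n)\ge\lambda\,\#I_n\}: s\in\mathcal F\}$ is large in $\mathbb N$. Let $X_{\mathcal F}$ be the completion of $c_{00}(I)$ (real scalars) under the norm $$\|x\|_{\mathcal F}=\max\Big\{\sup_{i\in I}|x_i|,\ \sup_{s\in\mathcal F}\sum_{i\in s}|x_i|\Big\},$$ with unit basis $(u_i)_{i\in I}$. For a nonempty, convex, symmetric and bounded subset $W$ of a normed space $X$ with closed unit ball $B_X$ and $1<p<\infty$, the Davis–Figiel–Johnson–Pełczyński interpolation space is $$\Delta_p(W,X)=\Big\{x\in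 X:\ \|x\|_Y:=\Big(\sum_{n\ge 1}|x|_n^p\Big)^{1/p}<\infty\Big\},\qquad |x|_n=\inf\{\lambda>0:\ x/\lambda\in 2^nW+2^{-n}B_X\}.$$ A subset $A$ of a normed space is *Banach–Saks* if every sequence in $A$ has a subsequence $(y_n)$ whose averages $\frac1n\sum_{k=1}^n y_k$ converge in norm. **Proposition.** Let $\mathcal F$ be a $T$-family on $I$, let $W$ be the closed absolutely convex hull of $\{u_i\}_{i\in I}$ in $X_{\mathcal F}$, and let $1<p<\infty$. Then $Y:=\Delta_p(W,X_{\mathcal F})$, with the norm $\|\cdot\|_Y$, is reflexive, and there is a weakly null sequence $(y_n)_n$ in $Y$ such that $\{y_n\}_n$ is a Banach–Saks subset of $Y$ but its convex hull is not. -/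

import Mathlib

open Filter Topology Set
open scoped Pointwise

noncomputable section

universe u

/-! ### Families of finite sets, largeness, `T`-families -/

/-- The family `F` of finite subsets of `I` is `n`-large in `J`: every infinite `K ⊆ J` meets some
member of `F` in at least `n` points. -/
def IsNLargeIn {I : Type u} (F : Set (Finset I)) (n : ℕ) (J : Set I) : Prop :=
  ∀ K : Set I, K ⊆ J → K.Infinite → ∃ s ∈ F, n ≤ ((s : Set I) ∩ K).ncard

/-- `F` is large in `J`: it is `n`-large in `J` for every `n`. -/
def IsLargeIn {I : Type u} (F : Set (Finset I)) (J : Set I) : Prop :=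
  ∀ n : ℕ, IsNLargeIn F n J

open Classical in
/-- `F` is pre-compact: its closure in the Cantor cube `{0,1}^I` (product of discrete spaces)
consists of (indicators of) finite sets. -/
def IsPrecompactFamily {I : Type u} (F : Set (Finset I)) : Prop :=
  ∀ g ∈ closure ((fun (s : Finset I) (i : I) => decide (i ∈ s)) '' F), {i | g i = true}.Finite

/-- A partition of `I` into finite (nonempty) pieces `P 0, P 1, …`. -/
structure IsFinitePartition {I : Type u} (P : ℕ → Finset I) : Prop where
  nonempty : ∀ n, (P n).Nonempty
  disjoint : ∀ m n, m ≠ n → Disjoint (P m) (P n)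
  cover : ∀ i, ∃ n, i ∈ P n

/-- The family `{s[lam] : s ∈ F}` where `s[lam] = {n : #(s ∩ Iₙ) ≥ lam * #Iₙ}`
(these sets are finite when the `Iₙ` form a partition into finite pieces and `lam > 0`). -/
def GFamily {I : Type u} (P : ℕ → Finset I) (lam : ℝ) (F : Set (Finset I)) : Set (Finset ℕ) :=
  {t | ∃ s ∈ F, ∀ n : ℕ,
    n ∈ t ↔ lam * ((P n).card : ℝ) ≤ (((s : Set I) ∩ (P n : Set I)).ncard : ℝ)}

/-- `T`-families on `I`. -/
structure IsTFamily {I : Type u} (F : Set (Finset I)) : Prop where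
  precompact : IsPrecompactFamily F
  exists_partition : ∃ P : ℕ → Finset I, IsFinitePartition P ∧
    (∀ J : Set I, J.Infinite → ¬ IsLargeIn F J) ∧
    ∃ lam : ℝ, 0 < lam ∧ lam ≤ 1 ∧ IsLargeIn (GFamily P lam F) Set.univ

/-! ### Schreier-like spaces -/

/-- The space `c₀₀(I)` of finitely supported real functions, to be normed by the family `F`. -/
def SchreierPre {I : Type u} (_F : Set (Finset I)) : Type u := I →₀ ℝ

namespace SchreierPre

variable {I : Type u} {F : Set (Finset I)}

instance : AddCommGroup (SchreierPre F) := inferInstanceAs (AddCommGroup (I →₀ ℝ))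
instance : Module ℝ (SchreierPre F) := inferInstanceAs (Module ℝ (I →₀ ℝ))

/-- The coordinates of a vector of `c₀₀(I)`. -/
def coord (x : SchreierPre F) (i : I) : ℝ := (show I →₀ ℝ from x) i

/-- The unit vectors of `c₀₀(I)`. -/
def unit (F : Set (Finset I)) (i : I) : SchreierPre F := (Finsupp.single i (1 : ℝ) : I →₀ ℝ)

/-- The Schreier-like norm `max (sup_i |x_i|) (sup_{s ∈ F} ∑_{i ∈ s} |x_i|)`. -/
instance : Norm (SchreierPre F) where
  norm x := max (⨆ i : I, |x.coord i|) (⨆ s : F, ∑ i ∈ s.1, |x.coord i|)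

theorem norm_def (x : SchreierPre F) :
    ‖x‖ = max (⨆ i : I, |x.coord i|) (⨆ s : F, ∑ i ∈ s.1, |x.coord i|) := rfl

theorem coord_add (x y : SchreierPre F) (i : I) : (x + y).coord i = x.coord i + y.coord i := rfl

theorem coord_smul (c : ℝ) (x : SchreierPre F) (i : I) : (c • x).coord i = c * x.coord i := rfl

theorem coord_zero (i : I) : (0 : SchreierPre F).coord i = 0 := rfl

theorem coord_ext {x y : SchreierPre F} (h : ∀ i, x.coord i = y.coord i) : x = y :=
  Finsupp.ext h

theorem sum_abs_le (x : SchreierPre F) (s : Finset I) :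
    ∑ i ∈ s, |x.coord i| ≤ ∑ i ∈ (show I →₀ ℝ from x).support, |x.coord i| := by
  classical
  have h1 : ∑ i ∈ s, |x.coord i| ≤ ∑ i ∈ s ∪ (show I →₀ ℝ from x).support, |x.coord i| :=
    Finset.sum_le_sum_of_subset_of_nonneg Finset.subset_union_left
      (fun i _ _ => abs_nonneg _)
  have h2 : ∑ i ∈ (show I →₀ ℝ from x).support, |x.coord i|
      = ∑ i ∈ s ∪ (show I →₀ ℝ from x).support, |x.coord i| := by
    refine Finset.sum_subset Finset.subset_union_right (fun i _ hi => ?_)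
    have : x.coord i = 0 := Finsupp.notMem_support_iff.1 hi
    simp [this]
  linarith

theorem bdd_coord (x : SchreierPre F) : BddAbove (Set.range fun i : I => |x.coord i|) := by
  refine ⟨∑ i ∈ (show I →₀ ℝ from x).support, |x.coord i|, ?_⟩
  rintro _ ⟨i, rfl⟩
  have := sum_abs_le x {i}
  simpa using this

theorem bdd_sum (x : SchreierPre F) :
    BddAbove (Set.range fun s : F => ∑ i ∈ s.1, |x.coord i|) := by
  refine ⟨∑ i ∈ (show I →₀ ℝ from x).support, |x.coord i|, ?_⟩
  rintro _ ⟨s, rfl⟩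
  exact sum_abs_le x s.1

theorem abs_coord_le (x : SchreierPre F) (i : I) : |x.coord i| ≤ ‖x‖ :=
  (le_ciSup (bdd_coord x) i).trans (le_max_left _ _)

theorem sum_le_norm (x : SchreierPre F) {s : Finset I} (hs : s ∈ F) :
    ∑ i ∈ s, |x.coord i| ≤ ‖x‖ :=
  (le_ciSup (bdd_sum x) (⟨s, hs⟩ : F)).trans (le_max_right _ _)

theorem norm_nonneg' (x : SchreierPre F) : 0 ≤ ‖x‖ :=
  (Real.iSup_nonneg fun _ => abs_nonneg _).trans (le_max_left _ _)

theorem norm_le_of {x : SchreierPre F} {c : ℝ} (hc : 0 ≤ c) (h1 : ∀ i, |x.coord i| ≤ c)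
    (h2 : ∀ s ∈ F, ∑ i ∈ s, |x.coord i| ≤ c) : ‖x‖ ≤ c :=
  max_le (Real.iSup_le h1 hc) (Real.iSup_le (fun s => h2 s.1 s.2) hc)

theorem normedCore (F : Set (Finset I)) : NormedSpace.Core ℝ (SchreierPre F) where
  norm_nonneg := norm_nonneg'
  norm_smul c x := by
    have e1 : ∀ i, |(c • x).coord i| = |c| * |x.coord i| := fun i => by
      rw [coord_smul, abs_mul]
    rw [norm_def, norm_def, Real.norm_eq_abs, mul_max_of_nonneg _ _ (abs_nonneg c),
      Real.mul_iSup_of_nonneg (abs_nonneg c), Real.mul_iSup_of_nonneg (abs_nonneg c)]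
    simp only [e1, Finset.mul_sum]
  norm_triangle x y := by
    refine norm_le_of (add_nonneg (norm_nonneg' x) (norm_nonneg' y)) (fun i => ?_)
      (fun s hs => ?_)
    · rw [coord_add]
      exact (abs_add_le _ _).trans (add_le_add (abs_coord_le x i) (abs_coord_le y i))
    · calc ∑ i ∈ s, |(x + y).coord i| ≤ ∑ i ∈ s, (|x.coord i| + |y.coord i|) :=
            Finset.sum_le_sum fun i _ => by rw [coord_add]; exact abs_add_le _ _
        _ = ∑ i ∈ s, |x.coord i| + ∑ i ∈ s, |y.coord i| := Finset.sum_add_distrib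
        _ ≤ ‖x‖ + ‖y‖ := add_le_add (sum_le_norm x hs) (sum_le_norm y hs)
  norm_eq_zero_iff x := by
    constructor
    · intro h
      refine coord_ext fun i => ?_
      have := abs_coord_le x i
      rw [h] at this
      rw [coord_zero]
      exact abs_nonpos_iff.1 this
    · rintro rfl
      refine le_antisymm (norm_le_of le_rfl ?_ ?_) (norm_nonneg' _)
      · intro i; simp [coord_zero]
      · intro s _; simp [coord_zero]

instance : NormedAddCommGroup (SchreierPre F) := NormedAddCommGroup.ofCore (normedCore F)
instance : NormedSpace ℝ (SchreierPre F) := NormedSpace.ofCore (normedCore F)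

theorem coord_unit_self (i : I) : (unit F i).coord i = 1 := Finsupp.single_eq_same

theorem coord_unit_of_ne {i j : I} (h : j ≠ i) : (unit F i).coord j = 0 :=
  Finsupp.single_eq_of_ne h

theorem norm_unit (i : I) : ‖unit F i‖ = 1 := by
  classical
  refine le_antisymm (norm_le_of zero_le_one (fun j => ?_) (fun s _ => ?_)) ?_
  · by_cases h : j = i
    · subst h; simp [coord_unit_self]
    · simp [coord_unit_of_ne h]
  · have h : ∀ j ∈ s, |(unit F i).coord j| = if i = j then 1 else 0 := by
      intro j _
      by_cases h : j = i
      · subst h; simp [coord_unit_self]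
      · simp [coord_unit_of_ne h, Ne.symm h]
    rw [Finset.sum_congr rfl h, Finset.sum_ite_eq]
    split_ifs <;> norm_num
  · have := abs_coord_le (unit F i) i
    simpa [coord_unit_self] using this

end SchreierPre

/-- The Schreier-like space `X_F`: the completion of `c₀₀(I)` under the norm of `F`. -/
abbrev SchreierSpace {I : Type u} (F : Set (Finset I)) : Type u :=
  UniformSpace.Completion (SchreierPre F)

/-- The unit basis of `X_F`. -/
def SchreierSpace.basisVec {I : Type u} (F : Set (Finset I)) (i : I) : SchreierSpace F :=
  ((SchreierPre.unit F i : SchreierPre F) : UniformSpace.Completion (SchreierPre F))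

/-! ### The Davis–Figiel–Johnson–Pełczyński interpolation space -/

/-- A nonempty, convex, symmetric and bounded subset of a normed space. -/
structure ConvexSymmetricBody (X : Type u) [NormedAddCommGroup X] [NormedSpace ℝ X] where
  carrier : Set X
  nonempty : carrier.Nonempty
  convex : Convex ℝ carrier
  symmetric : ∀ x ∈ carrier, -x ∈ carrier
  bounded : Bornology.IsBounded carrier

namespace ConvexSymmetricBody

variable {X : Type u} [NormedAddCommGroup X] [NormedSpace ℝ X] (W : ConvexSymmetricBody X)

/-- The set `2ⁿ W + 2⁻ⁿ B_X`, with `B_X` the closed unit ball of `X`. -/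
def levelSet (n : ℕ) : Set X :=
  (2 : ℝ) ^ n • W.carrier + ((2 : ℝ) ^ n)⁻¹ • Metric.closedBall (0 : X) 1

/-- `|x|ₙ = inf {lam > 0 : x / lam ∈ 2ⁿ W + 2⁻ⁿ B_X}`, the Minkowski functional. -/
def levelNorm (n : ℕ) (x : X) : ℝ := gauge (W.levelSet n) x

theorem zero_mem : (0 : X) ∈ W.carrier := by
  obtain ⟨x, hx⟩ := W.nonempty
  have h := W.convex hx (W.symmetric x hx) (by norm_num : (0 : ℝ) ≤ 1 / 2)
    (by norm_num : (0 : ℝ) ≤ 1 / 2) (by norm_num)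
  simpa using h

theorem levelSet_convex (n : ℕ) : Convex ℝ (W.levelSet n) :=
  (W.convex.smul _).add ((convex_closedBall 0 1).smul _)

theorem levelSet_symmetric (n : ℕ) : ∀ x ∈ W.levelSet n, -x ∈ W.levelSet n := by
  rintro _ ⟨_, ⟨w, hw, rfl⟩, _, ⟨b, hb, rfl⟩, rfl⟩
  refine ⟨_, ⟨-w, W.symmetric w hw, rfl⟩, _, ⟨-b, by simpa using hb, rfl⟩, ?_⟩
  simp only [smul_neg]
  abel

theorem levelSet_mem_nhds (n : ℕ) : W.levelSet n ∈ 𝓝 (0 : X) := by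
  have h2 : (0 : ℝ) < ((2 : ℝ) ^ n)⁻¹ := by positivity
  refine mem_of_superset (Metric.closedBall_mem_nhds (0 : X) h2) fun x hx => ?_
  refine ⟨0, ⟨0, W.zero_mem, smul_zero _⟩, x, ?_, zero_add x⟩
  rw [smul_closedBall _ _ zero_le_one]
  simpa using hx

theorem levelSet_absorbent (n : ℕ) : Absorbent ℝ (W.levelSet n) :=
  absorbent_nhds_zero (W.levelSet_mem_nhds n)

theorem levelSet_bounded (n : ℕ) : ∃ r : ℝ, 0 < r ∧ W.levelSet n ⊆ Metric.closedBall 0 r := by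
  have h : Bornology.IsBounded (W.levelSet n) :=
    (W.bounded.smul₀ _).add (Metric.isBounded_closedBall.smul₀ _)
  exact h.subset_closedBall_lt 0 0

theorem levelNorm_nonneg (n : ℕ) (x : X) : 0 ≤ W.levelNorm n x := gauge_nonneg x

theorem levelNorm_add_le (n : ℕ) (x y : X) :
    W.levelNorm n (x + y) ≤ W.levelNorm n x + W.levelNorm n y :=
  gauge_add_le (W.levelSet_convex n) (W.levelSet_absorbent n) x y

theorem levelNorm_smul (n : ℕ) (c : ℝ) (x : X) :
    W.levelNorm n (c • x) = |c| * W.levelNorm n x := by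
  have hneg := gauge_neg (W.levelSet_symmetric n)
  unfold levelNorm
  rcases abs_choice c with h | h
  · rw [h, gauge_smul_of_nonneg (abs_eq_self.1 h), smul_eq_mul]
  · have hc : 0 ≤ -c := by rw [← h]; exact abs_nonneg c
    rw [h, ← hneg (c • x), ← neg_smul, gauge_smul_of_nonneg hc, smul_eq_mul]

theorem levelNorm_eq_zero (n : ℕ) {x : X} (h : W.levelNorm n x = 0) : x = 0 := by
  obtain ⟨r, hr, hsub⟩ := W.levelSet_bounded n
  have := le_gauge_of_subset_closedBall (W.levelSet_absorbent n) hr.le hsub (x := x)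
  rw [show gauge (W.levelSet n) x = 0 from h, div_le_iff₀ hr, zero_mul] at this
  exact norm_le_zero_iff.1 this

theorem levelNorm_zero (n : ℕ) : W.levelNorm n (0 : X) = 0 := gauge_zero

/-- The vectors `x ∈ X` with `∑_{n ≥ 1} |x|ₙ^p < ∞`. -/
def interpSubmodule (p : ℝ) [hp : Fact (1 < p)] : Submodule ℝ X where
  carrier := {x | Summable fun n : ℕ => W.levelNorm (n + 1) x ^ p}
  zero_mem' := by
    have hp0 : p ≠ 0 := (zero_lt_one.trans hp.out).ne'
    simp [levelNorm_zero, Real.zero_rpow hp0]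
  add_mem' := by
    intro x y hx hy
    have h := Real.summable_Lp_add_of_nonneg hp.out.le
      (fun n => W.levelNorm_nonneg (n + 1) x) (fun n => W.levelNorm_nonneg (n + 1) y) hx hy
    refine Summable.of_nonneg_of_le (fun n => Real.rpow_nonneg (W.levelNorm_nonneg _ _) _)
      (fun n => ?_) h
    exact Real.rpow_le_rpow (W.levelNorm_nonneg _ _) (W.levelNorm_add_le _ x y)
      (zero_lt_one.trans hp.out).le
  smul_mem' := by
    intro c x hx
    have e : ∀ n : ℕ, W.levelNorm (n + 1) (c • x) ^ p = |c| ^ p * W.levelNorm (n + 1) x ^ p :=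
      fun n => by rw [levelNorm_smul, Real.mul_rpow (abs_nonneg c) (W.levelNorm_nonneg _ _)]
    simp only [Set.mem_ofPred_eq, e]
    exact Summable.mul_left _ hx

/-- The interpolation space `Δ_p(W, X)`, `1 < p < ∞`; its norm is defined below (it is not the
norm inherited from `X`). -/
def InterpSpace (p : ℝ) [Fact (1 < p)] : Type u := W.interpSubmodule p

namespace InterpSpace

variable {W} {p : ℝ} [hp : Fact (1 < p)]

instance : AddCommGroup (W.InterpSpace p) := inferInstanceAs (AddCommGroup (W.interpSubmodule p))
instance : Module ℝ (W.InterpSpace p) := inferInstanceAs (Module ℝ (W.interpSubmodule p))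

/-- The inclusion of `Δ_p(W, X)` into `X`. -/
def incl : W.InterpSpace p →ₗ[ℝ] X := (W.interpSubmodule p).subtype

/-- `‖x‖_Y = ‖(|x|ₙ)_{n ≥ 1}‖_{ℓ_p}`. -/
instance : Norm (W.InterpSpace p) where
  norm x := (∑' n : ℕ, W.levelNorm (n + 1) (incl x) ^ p) ^ (1 / p)

theorem norm_def (x : W.InterpSpace p) :
    ‖x‖ = (∑' n : ℕ, W.levelNorm (n + 1) (incl x) ^ p) ^ (1 / p) := rfl

theorem summable (x : W.InterpSpace p) :
    Summable fun n : ℕ => W.levelNorm (n + 1) (incl x) ^ p := x.2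

theorem incl_injective : Function.Injective (incl : W.InterpSpace p →ₗ[ℝ] X) :=
  Subtype.val_injective

theorem term_nonneg (x : W.InterpSpace p) (n : ℕ) : 0 ≤ W.levelNorm (n + 1) (incl x) ^ p :=
  Real.rpow_nonneg (W.levelNorm_nonneg _ _) _

theorem normedCore (W : ConvexSymmetricBody X) (p : ℝ) [hp : Fact (1 < p)] :
    NormedSpace.Core ℝ (W.InterpSpace p) where
  norm_nonneg x := Real.rpow_nonneg (tsum_nonneg (term_nonneg x)) _
  norm_smul c x := by
    have hp0 : p ≠ 0 := (zero_lt_one.trans hp.out).ne'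
    have e : ∀ n : ℕ, W.levelNorm (n + 1) (incl (c • x)) ^ p
        = |c| ^ p * W.levelNorm (n + 1) (incl x) ^ p := fun n => by
      rw [map_smul, levelNorm_smul, Real.mul_rpow (abs_nonneg c) (W.levelNorm_nonneg _ _)]
    simp only [norm_def, e]
    rw [tsum_mul_left, Real.mul_rpow (Real.rpow_nonneg (abs_nonneg c) _)
      (tsum_nonneg (term_nonneg x)), ← Real.rpow_mul (abs_nonneg c), mul_one_div_cancel hp0,
      Real.rpow_one, Real.norm_eq_abs]
  norm_triangle x y := by
    have hpos : 0 < p := zero_lt_one.trans hp.out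
    have h := Real.Lp_add_le_tsum_of_nonneg hp.out.le
      (fun n => W.levelNorm_nonneg (n + 1) (incl x))
      (fun n => W.levelNorm_nonneg (n + 1) (incl y)) (summable x) (summable y)
    refine le_trans ?_ h.2
    rw [norm_def]
    refine Real.rpow_le_rpow (tsum_nonneg (term_nonneg _)) ?_ (by positivity)
    refine (summable (x + y)).tsum_le_tsum (fun n => ?_) h.1
    rw [map_add]
    exact Real.rpow_le_rpow (W.levelNorm_nonneg _ _) (W.levelNorm_add_le _ _ _) hpos.le
  norm_eq_zero_iff x := by
    have hpos : 0 < p := zero_lt_one.trans hp.out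
    constructor
    · intro h
      have h0 : ∑' n : ℕ, W.levelNorm (n + 1) (incl x) ^ p = 0 :=
        (Real.rpow_eq_zero (tsum_nonneg (term_nonneg x)) (by positivity)).1 h
      have h1 := (hasSum_zero_iff_of_nonneg (term_nonneg x)).1 (h0 ▸ (summable x).hasSum)
      have h2 : W.levelNorm (0 + 1) (incl x) ^ p = 0 := congrFun h1 0
      have h3 := (Real.rpow_eq_zero (W.levelNorm_nonneg _ _) hpos.ne').1 h2
      refine incl_injective ?_
      rw [W.levelNorm_eq_zero _ h3, map_zero]
    · rintro rfl
      simp [norm_def, levelNorm_zero, Real.zero_rpow hpos.ne', Real.zero_rpow (inv_pos.2 hpos).ne']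

instance : NormedAddCommGroup (W.InterpSpace p) := NormedAddCommGroup.ofCore (normedCore W p)
instance : NormedSpace ℝ (W.InterpSpace p) := NormedSpace.ofCore (normedCore W p)

end InterpSpace

end ConvexSymmetricBody

theorem SchreierSpace.hull_subset {I : Type u} (F : Set (Finset I)) :
    closedAbsConvexHull ℝ (Set.range (SchreierSpace.basisVec F)) ⊆ Metric.closedBall 0 1 := by
  refine closedAbsConvexHull_min ?_ ⟨balanced_closedBall_zero, convex_closedBall _ _⟩
    Metric.isClosed_closedBall
  rintro _ ⟨i, rfl⟩
  simp [SchreierSpace.basisVec, UniformSpace.Completion.norm_coe, SchreierPre.norm_unit]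

/-- The closed absolutely convex hull of the unit basis of `X_F`. -/
def SchreierSpace.basisHull {I : Type u} [Nonempty I] (F : Set (Finset I)) :
    ConvexSymmetricBody (SchreierSpace F) where
  carrier := closedAbsConvexHull ℝ (Set.range (SchreierSpace.basisVec F))
  nonempty := (Set.range_nonempty (SchreierSpace.basisVec F)).mono subset_closedAbsConvexHull
  convex := absConvex_convexClosedHull.2
  symmetric _ hx := absConvex_convexClosedHull.1.neg_mem_iff.2 hx
  bounded := Metric.isBounded_closedBall.subset (SchreierSpace.hull_subset F)

/-! ### Banach space notions -/

/-- `A` is a Banach–Saks set: every sequence in `A` has a subsequence whose averages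
`(1/n) ∑_{k=1}^n y_k` converge in norm. -/
def IsBanachSaksSet {E : Type u} [NormedAddCommGroup E] [NormedSpace ℝ E] (A : Set E) : Prop :=
  ∀ x : ℕ → E, (∀ n, x n ∈ A) → ∃ φ : ℕ → ℕ, StrictMono φ ∧ ∃ l : E,
    Tendsto (fun n : ℕ => (n : ℝ)⁻¹ • ∑ k ∈ Finset.range n, x (φ k)) atTop (𝓝 l)

/-- The sequence `x` is weakly null. -/
def IsWeaklyNull {E : Type u} [NormedAddCommGroup E] [NormedSpace ℝ E] (x : ℕ → E) : Prop :=
  ∀ f : StrongDual ℝ E, Tendsto (fun n => f (x n)) atTop (𝓝 0)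

/-- `E` is reflexive: the canonical isometric embedding into the bidual is onto (in particular `E`
is complete). -/
def IsReflexiveSpace (E : Type u) [NormedAddCommGroup E] [NormedSpace ℝ E] : Prop :=
  Function.Surjective (NormedSpace.inclusionInDoubleDual ℝ E)

end

/-!
Write `u i` for the unit basis of `X_F`, and `W` for its closed absolutely convex hull.

*Null averages.* Since `F` is not large in any infinite set, every sequence of distinct `u i` has a
subsequence whose first `m` terms are met by each member of `F` in at most `n` points, so that its
averages have norm at most `(n + 1) / m` (`SchreierSpace.hasNullAverages_basisVec`). All these
averages lie in `W`, and on `W` the level norms `|·|ₙ` are dominated by `2⁻ⁿ`; hence the averages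
tend to `0` in `Y = Δ_p(W, X_F)` as well (`InterpSpace.tendsto_zero_of_mem_of_incl`). A family whose
sequences have null averages is weakly null and has a Banach–Saks range
(`HasNullAverages.tendsto_cofinite`, `HasNullAverages.isBanachSaksSet_range`). An enumeration of
the `u i`, seen in `Y`, is therefore the required sequence.

*Reflexivity.* Elements of `W` are approximated by combinations of the `u i` with coefficients in
the unit ball of `ℓ₁`. Coordinatewise limits of the coefficients along an ultrafilter are weak
limits, because the `u i` are weakly null; so `W` is relatively weakly compact
(`exists_weakTendsto_of_mem_closedAbsConvexHull`). By Goldstine's theorem an element of the bidual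
of `Y` is the limit of an ultrafilter on a ball of `Y`. That ball is contained in
`C (2ⁿ W + 2⁻ⁿ B)` for every `n`, so Grothendieck's criterion gives a weak limit in `X_F`, which
belongs to `Y` since balls of `Y` are closed in `X_F`. Finally the convergence is weak in `Y`: a
bounded sequence of `Y` tending to `0` in `X_F` is essentially disjointly supported in an
`ℓ_p`-sum, and `p > 1` forbids a functional to stay away from `0` on it
(`InterpSpace.weakTendsto_of_incl`, `InterpSpace.isReflexiveSpace`).

*The convex hull.* An infinite Ramsey argument along an ultrafilter yields a subsequence of the
blocks of the partition such that any `m` of them beyond the `m`-th are simultaneously filled in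
proportion at least `lam` by a member of `F` (`IsLargeIn.exists_strictMono_subset`). The averages of
`u` over these blocks lie in the convex hull and are weakly null, but the mean of any `2 m` of them
has norm at least `lam / 2` (`SchreierSpace.not_isBanachSaksSet_convexHull`).
-/

/-! ### A Ramsey argument along an ultrafilter -/

/-- If `Q (k + 1) t` says that `Q k (insert i t)` holds for almost all `i` along the
hyperfilter, then along some subsequence `N` of the integers the value of `Q 0` on a finite set
depends only on its cardinality, as soon as the set starts late enough. This is the infinite
Ramsey theorem for all exponents at once. -/
theorem exists_strictMono_iff_of_hyperfilter (Q : ℕ → Finset ℕ → Prop)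
    (hQ : ∀ k t, Q (k + 1) t ↔ ∀ᶠ i in (hyperfilter ℕ : Filter ℕ), Q k (insert i t)) :
    ∃ N : ℕ → ℕ, StrictMono N ∧ ∀ t : Finset ℕ,
      (∀ i ∈ t, ∃ j, t.card ≤ j ∧ i = N j) → (Q t.card ∅ ↔ Q 0 t) := by
  -- a good successor `i` of `v` decides all questions about sets below `v` and exponents `≤ v`
  have step : ∀ v : ℕ, ∃ i, v < i ∧ ∀ t ∈ (Finset.range (v + 1)).powerset,
      ∀ k ∈ Finset.range (v + 1), (Q (k + 1) t ↔ Q k (insert i t)) := by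
    intro v
    have h1 : ∀ᶠ i in (hyperfilter ℕ : Filter ℕ), v < i :=
      (Nat.hyperfilter_le_atTop) (eventually_gt_atTop v)
    have h2 : ∀ᶠ i in (hyperfilter ℕ : Filter ℕ), ∀ t ∈ (Finset.range (v + 1)).powerset,
        ∀ k ∈ Finset.range (v + 1), (Q (k + 1) t ↔ Q k (insert i t)) := by
      rw [Finset.eventually_all]
      intro t _
      rw [Finset.eventually_all]
      intro k _
      by_cases h : Q (k + 1) t
      · filter_upwards [(hQ k t).1 h] with i hi
        exact iff_of_true h hi
      · have h' : ∀ᶠ i in (hyperfilter ℕ : Filter ℕ), ¬ Q k (insert i t) := by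
          rw [Ultrafilter.eventually_not]
          exact fun h3 => h ((hQ k t).2 h3)
        filter_upwards [h'] with i hi
        exact iff_of_false h hi
    exact (h1.and h2).exists
  choose g hg1 hg2 using step
  let N : ℕ → ℕ := fun j => g^[j] 0
  have hN : ∀ j, N (j + 1) = g (N j) := fun j => Function.iterate_succ_apply' g j 0
  have hmono : StrictMono N := strictMono_nat_of_lt_succ fun j => by rw [hN]; exact hg1 _
  refine ⟨N, hmono, fun t ht => ?_⟩
  have key : ∀ n : ℕ, ∀ t : Finset ℕ, (∀ i ∈ t, ∃ j, n ≤ j ∧ i = N j) →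
      ∀ k, t.card + k = n → (Q n ∅ ↔ Q k t) := by
    intro n t
    induction t using Finset.induction_on_max with
    | empty => intro _ k hk; simp at hk; rw [hk]
    | insert a s hs ih =>
      intro hmem k hk
      have ha : a ∉ s := fun h => lt_irrefl _ (hs a h)
      rw [Finset.card_insert_of_notMem ha] at hk
      obtain ⟨j, hj, haj⟩ := hmem a (Finset.mem_insert_self _ _)
      obtain ⟨j, rfl⟩ : ∃ j', j = j' + 1 := ⟨j - 1, by omega⟩
      rw [ih (fun i hi => hmem i (Finset.mem_insert_of_mem hi)) (k + 1) (by omega), haj, hN]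
      refine hg2 _ _ ?_ _ ?_
      · rw [Finset.mem_powerset]
        intro x hx
        obtain ⟨j', -, hxj⟩ := hmem x (Finset.mem_insert_of_mem hx)
        have h1 := hs x hx
        rw [hxj, haj, hmono.lt_iff_lt] at h1
        rw [Finset.mem_range, hxj]
        exact Nat.lt_succ_of_le (hmono.monotone (by omega))
      · have := hmono.le_apply (x := j)
        rw [Finset.mem_range]
        omega
  exact key _ t ht 0 (by omega)

/-- A large family on `ℕ` contains a copy of the Schreier family in its hereditary closure:
along some subsequence `N`, every finite `t ⊆ {N j : j ≥ #t}` lies in a member of the family. -/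
theorem IsLargeIn.exists_strictMono_subset {G : Set (Finset ℕ)} (hG : IsLargeIn G univ) :
    ∃ N : ℕ → ℕ, StrictMono N ∧ ∀ t : Finset ℕ, (∀ i ∈ t, ∃ j, t.card ≤ j ∧ i = N j) →
      ∃ g ∈ G, t ⊆ g := by
  let Q : ℕ → Finset ℕ → Prop := fun k => Nat.rec (fun t => ∃ g ∈ G, t ⊆ g)
    (fun _ R t => ∀ᶠ i in (hyperfilter ℕ : Filter ℕ), R (insert i t)) k
  obtain ⟨N, hN, h⟩ := exists_strictMono_iff_of_hyperfilter Q fun _ _ => Iff.rfl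
  refine ⟨N, hN, fun t ht => (h t ht).1 ?_⟩
  -- some set of the same cardinality, starting equally late, lies in a member of `G`
  obtain ⟨g, hg, hcard⟩ := hG t.card (N '' Ici t.card) (subset_univ _)
    ((Ici_infinite _).image hN.injective.injOn)
  have hfin : ((g : Set ℕ) ∩ N '' Ici t.card).Finite := g.finite_toSet.inter_of_left _
  rw [ncard_eq_toFinset_card _ hfin] at hcard
  obtain ⟨t', ht', hc⟩ := Finset.exists_subset_card_eq hcard
  have hmem : ∀ i ∈ t', i ∈ g ∧ ∃ j, t.card ≤ j ∧ N j = i := fun i hi => by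
    simpa using ht' hi
  rw [← hc]
  refine (h t' fun i hi => ?_).2 ⟨g, hg, fun i hi => (hmem i hi).1⟩
  obtain ⟨-, j, hj, rfl⟩ := hmem i hi
  exact ⟨j, hc.symm ▸ hj, rfl⟩

/-! ### Weak limits along filters -/

/-- `g` converges weakly to `x` along the filter `l`, tested on continuous functionals. -/
def WeakTendsto {ι X : Type*} [NormedAddCommGroup X] [NormedSpace ℝ X]
    (g : ι → X) (l : Filter ι) (x : X) : Prop :=
  ∀ f : StrongDual ℝ X, Tendsto (fun i => f (g i)) l (𝓝 (f x))

section WeakLimits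

variable {ι X : Type*} [NormedAddCommGroup X] [NormedSpace ℝ X] {l : Filter ι}

theorem WeakTendsto.const_smul {g : ι → X} {x : X} (h : WeakTendsto g l x) (c : ℝ) :
    WeakTendsto (fun i => c • g i) l (c • x) := fun f => by
  simpa using (h f).const_mul c

theorem WeakTendsto.sub {g g' : ι → X} {x x' : X} (h : WeakTendsto g l x)
    (h' : WeakTendsto g' l x') : WeakTendsto (fun i => g i - g' i) l (x - x') := fun f => by
  simpa using (h f).sub (h' f)

theorem WeakTendsto.mem_of_frequently {g : ι → X} {x : X} (h : WeakTendsto g l x) {S : Set X}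
    (hS : Convex ℝ S) (hc : IsClosed S) (hg : ∃ᶠ i in l, g i ∈ S) : x ∈ S := by
  by_contra hx
  obtain ⟨f, u, hf, hu⟩ := geometric_hahn_banach_closed_point hS hc hx
  obtain ⟨i, hi, hi'⟩ := (hg.and_eventually ((h f).eventually_const_lt hu)).exists
  exact lt_asymm hi' (hf _ hi)

theorem WeakTendsto.norm_le [l.NeBot] {g : ι → X} {x : X} (h : WeakTendsto g l x) {C : ℝ}
    (hg : ∀ᶠ i in l, ‖g i‖ ≤ C) : ‖x‖ ≤ C := by
  have := h.mem_of_frequently (convex_closedBall (0 : X) C) Metric.isClosed_closedBall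
    (hg.mono fun i hi => by simpa using hi).frequently
  simpa using this

/-- Uniform approximation by weakly convergent families yields a weak limit; this is
Grothendieck's criterion for relative weak compactness. -/
theorem exists_weakTendsto_of_approx [CompleteSpace X] [l.NeBot] (g : ι → X)
    (h : ∀ ε > 0, ∃ (v : ι → X) (x : X), (∀ᶠ i in l, ‖g i - v i‖ ≤ ε) ∧ WeakTendsto v l x) :
    ∃ x, WeakTendsto g l x := by
  have hpos : ∀ n : ℕ, (0 : ℝ) < 1 / (n + 1) := fun n => Nat.one_div_pos_of_nat
  choose v x hv hx using fun n : ℕ => h (1 / (n + 1)) (hpos n)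
  have hdist : ∀ n m, dist (x n) (x m) ≤ 1 / ((n : ℝ) + 1) + 1 / (m + 1) := by
    intro n m
    rw [dist_eq_norm]
    refine ((hx n).sub (hx m)).norm_le ?_
    filter_upwards [hv n, hv m] with i hn hm
    calc ‖v n i - v m i‖ = ‖(g i - v m i) - (g i - v n i)‖ := by congr 1; abel
      _ ≤ ‖g i - v m i‖ + ‖g i - v n i‖ := norm_sub_le _ _
      _ ≤ _ := by linarith
  have hb : Tendsto (fun n : ℕ => 1 / ((n : ℝ) + 1) + 1 / (n + 1)) atTop (𝓝 0) := by
    simpa using (tendsto_one_div_add_atTop_nhds_zero_nat (𝕜 := ℝ)).add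
      tendsto_one_div_add_atTop_nhds_zero_nat
  have hcauchy : CauchySeq x := by
    refine cauchySeq_of_le_tendsto_0 _ (fun n m N hn hm => (hdist n m).trans ?_) hb
    exact add_le_add (Nat.one_div_le_one_div hn) (Nat.one_div_le_one_div hm)
  obtain ⟨y, hy⟩ := cauchySeq_tendsto_of_complete hcauchy
  refine ⟨y, fun f => ?_⟩
  rw [Metric.tendsto_nhds]
  intro ε hε
  have h1 : Tendsto (fun n : ℕ => ‖f‖ * (1 / ((n : ℝ) + 1)) + ‖f‖ * ‖x n - y‖) atTop (𝓝 0) := by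
    have h2 : Tendsto (fun n => ‖x n - y‖) atTop (𝓝 0) := by
      simpa [dist_eq_norm] using tendsto_iff_dist_tendsto_zero.1 hy
    simpa using ((tendsto_one_div_add_atTop_nhds_zero_nat (𝕜 := ℝ)).const_mul ‖f‖).add
      (h2.const_mul ‖f‖)
  obtain ⟨n, hn⟩ := (h1.eventually_lt_const (half_pos hε)).exists
  filter_upwards [hv n, Metric.tendsto_nhds.1 (hx n f) (ε / 2) (half_pos hε)] with i hi hi'
  rw [Real.dist_eq] at hi' ⊢
  have e : f (g i) - f y = f (g i - v n i) + (f (v n i) - f (x n)) + f (x n - y) := by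
    simp only [map_sub]; ring
  have h3 : |f (g i - v n i)| ≤ ‖f‖ * (1 / ((n : ℝ) + 1)) :=
    (f.le_opNorm _).trans (mul_le_mul_of_nonneg_left hi (norm_nonneg _))
  have h4 : |f (x n - y)| ≤ ‖f‖ * ‖x n - y‖ := f.le_opNorm _
  rw [e]
  calc _ ≤ |f (g i - v n i)| + |f (v n i) - f (x n)| + |f (x n - y)| := abs_add_three _ _ _
    _ < ε := by linarith

end WeakLimits

section Goldstine

variable {Y : Type*} [NormedAddCommGroup Y] [NormedSpace ℝ Y]

/-- Helly's theorem: finitely many values of a functional on the dual are nearly attained on a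
ball of radius `‖Φ‖ + 1`. -/
theorem exists_norm_le_abs_sub_lt (Φ : StrongDual ℝ (StrongDual ℝ Y))
    (s : Finset (StrongDual ℝ Y)) {ε : ℝ} (hε : 0 < ε) :
    ∃ y : Y, ‖y‖ ≤ ‖Φ‖ + 1 ∧ ∀ f ∈ s, |f y - Φ f| < ε := by
  classical
  set R : ℝ := ‖Φ‖ + 1
  have hR : 0 < R := by positivity
  let T : Y →ₗ[ℝ] (s → ℝ) := LinearMap.pi fun f => (f.1 : Y →ₗ[ℝ] ℝ)
  have hmem : (fun f : s => Φ f.1) ∈ closure (T '' Metric.closedBall 0 R) := by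
    by_contra hx
    obtain ⟨a, u, ha, hu⟩ := geometric_hahn_banach_closed_point
      ((convex_closedBall (0 : Y) R).linear_image T).closure isClosed_closure hx
    have hrep : ∀ w : s → ℝ, a w = ∑ f, w f * a (fun j => if f = j then 1 else 0) := fun w => by
      simpa using LinearMap.pi_apply_eq_sum_univ (a : (s → ℝ) →ₗ[ℝ] ℝ) w
    -- the separating functional is evaluation at `h`
    let h : StrongDual ℝ Y := ∑ f : s, a (fun j => if f = j then 1 else 0) • f.1
    have hT : ∀ y, a (T y) = h y := fun y => by
      rw [hrep]; simp [h, T, mul_comm]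
    have hΦ : a (fun f : s => Φ f.1) = Φ h := by
      rw [hrep]; simp [h, mul_comm]
    have hball : ∀ y : Y, ‖y‖ ≤ R → h y < u := fun y hy => by
      rw [← hT]; exact ha _ (subset_closure ⟨y, by simpa using hy, rfl⟩)
    have hu0 : 0 < u := by simpa using hball 0 (by simpa using hR.le)
    have hle : ‖h‖ ≤ u / R := by
      refine ContinuousLinearMap.opNorm_le_of_unit_norm (by positivity) fun x hx => ?_
      have hxR : ‖R • x‖ ≤ R := by rw [norm_smul, hx, mul_one, Real.norm_of_nonneg hR.le]
      have h1 := hball (R • x) hxR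
      have h2 := hball (-(R • x)) (by rwa [norm_neg])
      simp only [map_neg, map_smul, smul_eq_mul] at h1 h2
      rw [Real.norm_eq_abs, le_div_iff₀ hR, ← abs_of_pos hR, ← abs_mul, abs_le,
        mul_comm]
      constructor <;> linarith
    have : Φ h ≤ u := by
      calc Φ h ≤ ‖Φ‖ * ‖h‖ := (le_abs_self _).trans (Φ.le_opNorm h)
        _ ≤ R * (u / R) := mul_le_mul (by simp [R]) hle (norm_nonneg _) hR.le
        _ = u := by field_simp
    rw [hΦ] at hu
    exact absurd hu this.not_gt
  obtain ⟨_, ⟨y, hy, rfl⟩, hd⟩ := Metric.mem_closure_iff.1 hmem ε hε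
  refine ⟨y, by simpa using hy, fun f hf => ?_⟩
  have := (dist_pi_lt_iff hε).1 hd ⟨f, hf⟩
  rwa [dist_comm] at this

/-- Goldstine's theorem in terms of ultrafilters. -/
theorem exists_ultrafilter_tendsto_bidual (Φ : StrongDual ℝ (StrongDual ℝ Y)) :
    ∃ U : Ultrafilter Y, (∀ᶠ y in (U : Filter Y), ‖y‖ ≤ ‖Φ‖ + 1) ∧
      ∀ f : StrongDual ℝ Y, Tendsto (fun y => f y) U (𝓝 (Φ f)) := by
  classical
  choose y hy hy' using fun q : Finset (StrongDual ℝ Y) × ℕ =>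
    exists_norm_le_abs_sub_lt Φ q.1 (Nat.one_div_pos_of_nat (α := ℝ) (n := q.2))
  refine ⟨Ultrafilter.of (map y atTop),
    Ultrafilter.of_le _ (eventually_map.2 (Eventually.of_forall hy)), fun f => ?_⟩
  suffices h : Tendsto (fun q => f (y q)) atTop (𝓝 (Φ f)) from
    (tendsto_map'_iff.2 h).mono_left (Ultrafilter.of_le _)
  rw [Metric.tendsto_nhds]
  intro ε hε
  obtain ⟨n, hn⟩ := exists_nat_one_div_lt hε
  filter_upwards [eventually_ge_atTop (({f}, n) : Finset (StrongDual ℝ Y) × ℕ)] with q hq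
  refine (hy' q f (hq.1 (Finset.mem_singleton_self f))).trans (lt_of_le_of_lt ?_ hn)
  exact Nat.one_div_le_one_div hq.2

end Goldstine

/-! ### The interpolation space -/

namespace ConvexSymmetricBody

universe u

variable {X : Type u} [NormedAddCommGroup X] [NormedSpace ℝ X] (W : ConvexSymmetricBody X)

theorem continuous_levelNorm (n : ℕ) : Continuous (W.levelNorm n) :=
  continuous_gauge (W.levelSet_convex n) (W.levelSet_mem_nhds n)

theorem levelNorm_le_of_mem {x : X} (hx : x ∈ W.carrier) (n : ℕ) :
    W.levelNorm n x ≤ ((2 : ℝ) ^ n)⁻¹ := by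
  refine gauge_le_of_mem (by positivity) ?_
  have h2 : ((2 : ℝ) ^ n) ≠ 0 := by positivity
  refine (mem_inv_smul_set_iff₀ h2 _ _).2 ?_
  exact ⟨(2 : ℝ) ^ n • x, smul_mem_smul_set hx, 0, ⟨0, by simp, by simp⟩, by simp⟩

namespace InterpSpace

variable {W} {p : ℝ} [hp : Fact (1 < p)]

theorem p_pos (p : ℝ) [hp : Fact (1 < p)] : 0 < p := zero_lt_one.trans hp.out

theorem norm_rpow (x : W.InterpSpace p) :
    ‖x‖ ^ p = ∑' n : ℕ, W.levelNorm (n + 1) (incl x) ^ p := by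
  rw [norm_def, ← Real.rpow_mul (tsum_nonneg (term_nonneg x)), one_div,
    inv_mul_cancel₀ (p_pos p).ne', Real.rpow_one]

theorem levelNorm_le_norm (x : W.InterpSpace p) (n : ℕ) :
    W.levelNorm (n + 1) (incl x) ≤ ‖x‖ := by
  rw [← Real.rpow_le_rpow_iff (W.levelNorm_nonneg _ _) (norm_nonneg _) (p_pos p), norm_rpow]
  exact (summable x).le_tsum n fun m _ => term_nonneg x m

variable (W p) in
theorem exists_norm_incl_le : ∃ C, ∀ x : W.InterpSpace p, ‖incl x‖ ≤ C * ‖x‖ := by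
  obtain ⟨r, hr, hsub⟩ := W.levelSet_bounded 1
  refine ⟨r, fun x => ?_⟩
  have h1 := le_gauge_of_subset_closedBall (W.levelSet_absorbent 1) hr.le hsub (x := incl x)
  rw [div_le_iff₀' hr] at h1
  exact h1.trans (mul_le_mul_of_nonneg_left (levelNorm_le_norm x 0) hr.le)

variable (W p) in
/-- The inclusion of `Δ_p(W, X)` into `X` as a bounded operator. -/
noncomputable def inclL : W.InterpSpace p →L[ℝ] X :=
  LinearMap.mkContinuousOfExistsBound incl (exists_norm_incl_le W p)

@[simp] theorem inclL_apply (x : W.InterpSpace p) : inclL W p x = incl x := rfl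

theorem summable_inv_two_pow_rpow (p : ℝ) [hp : Fact (1 < p)] :
    Summable fun n : ℕ => (((2 : ℝ) ^ (n + 1))⁻¹) ^ p := by
  have h1 : Summable fun n : ℕ => (((2 : ℝ)⁻¹ ^ p) ^ (n + 1)) := by
    refine (summable_nat_add_iff 1).2 (summable_geometric_of_lt_one (by positivity) ?_)
    exact Real.rpow_lt_one (by norm_num) (by norm_num) (p_pos p)
  refine h1.congr fun n => ?_
  rw [← inv_pow, ← Real.rpow_natCast, ← Real.rpow_natCast, ← Real.rpow_mul (by norm_num),
    ← Real.rpow_mul (by norm_num), mul_comm]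

variable (p) in
theorem mem_interpSubmodule_of_mem {x : X} (hx : x ∈ W.carrier) : x ∈ W.interpSubmodule p :=
  Summable.of_nonneg_of_le (fun _ => Real.rpow_nonneg (W.levelNorm_nonneg _ _) _)
    (fun _ => Real.rpow_le_rpow (W.levelNorm_nonneg _ _) (W.levelNorm_le_of_mem hx _)
      (p_pos p).le) (summable_inv_two_pow_rpow p)

/-- On `W`, convergence to `0` in `X` implies convergence to `0` in the interpolation space: the
level norms are dominated on `W` by a geometric sequence. -/
theorem tendsto_zero_of_mem_of_incl {ι : Type*} {l : Filter ι} {z : ι → W.InterpSpace p}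
    (hz : ∀ i, incl (z i) ∈ W.carrier) (h : Tendsto (fun i => incl (z i)) l (𝓝 0)) :
    Tendsto z l (𝓝 0) := by
  have hpos := p_pos p
  rw [tendsto_zero_iff_norm_tendsto_zero]
  have hlim : Tendsto (fun i => ∑' n : ℕ, W.levelNorm (n + 1) (incl (z i)) ^ p) l
      (𝓝 (∑' _ : ℕ, (0 : ℝ))) := by
    refine tendsto_tsum_of_dominated_convergence (summable_inv_two_pow_rpow p) (fun n => ?_)
      (Eventually.of_forall fun i n => ?_)
    · have h1 : Tendsto (fun i => W.levelNorm (n + 1) (incl (z i))) l (𝓝 0) := by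
        simpa [levelNorm_zero, Function.comp_def] using
          ((W.continuous_levelNorm (n + 1)).tendsto 0).comp h
      simpa [Real.zero_rpow hpos.ne'] using h1.rpow_const (p := p) (Or.inr hpos.le)
    · rw [Real.norm_of_nonneg (term_nonneg _ _)]
      exact Real.rpow_le_rpow (W.levelNorm_nonneg _ _) (W.levelNorm_le_of_mem (hz i) _) hpos.le
  have h2 := hlim.rpow_const (p := 1 / p) (Or.inr (by positivity))
  simpa [norm_def, Real.zero_rpow (inv_pos.2 hpos).ne'] using h2

/-- The gliding hump: a bounded sequence tending to `0` in `X` has all its level norms tending to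
`0`, so a far enough term is almost disjoint from `u` as an element of an `ℓ_p`-sum. -/
theorem exists_norm_add_rpow_le {R : ℝ} {z : ℕ → W.InterpSpace p} (hR : ∀ k, ‖z k‖ ≤ R)
    (hz : Tendsto (fun k => incl (z k)) atTop (𝓝 0)) (u : W.InterpSpace p) :
    ∃ k, ‖u + z k‖ ^ p ≤ ‖u‖ ^ p + R ^ p + 1 := by
  have hpos := p_pos p
  have hR0 : 0 ≤ R := (norm_nonneg _).trans (hR 0)
  obtain ⟨ε, hε, hεR⟩ : ∃ ε > 0, (ε + R) ^ p < R ^ p + 1 / 2 := by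
    have h1 : Tendsto (fun ε : ℝ => (ε + R) ^ p) (𝓝[>] 0) (𝓝 (R ^ p)) := by
      have h2 : Tendsto (fun ε : ℝ => ε + R) (𝓝[>] 0) (𝓝 R) :=
        tendsto_nhdsWithin_of_tendsto_nhds (by
          simpa using (continuous_add_const R).tendsto 0)
      exact h2.rpow_const (Or.inr hpos.le)
    obtain ⟨ε, h3, h4⟩ := ((h1.eventually_lt_const (show R ^ p < R ^ p + 1 / 2 by linarith)).and
      self_mem_nhdsWithin).exists
    exact ⟨ε, h4, h3⟩
  have hε' : 0 < ε ^ p := Real.rpow_pos_of_pos hε p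
  -- the tail of `u` beyond `N` has norm at most `ε`
  obtain ⟨N, hN⟩ : ∃ N, ∑' n, W.levelNorm (n + N + 1) (incl u) ^ p < ε ^ p :=
    ((tendsto_sum_nat_add fun n => W.levelNorm (n + 1) (incl u) ^ p).eventually_lt_const hε').exists
  have hshift : ∀ x : W.InterpSpace p, Summable fun n => W.levelNorm (n + N + 1) (incl x) ^ p :=
    fun x => (summable_nat_add_iff N).2 (summable x)
  have hsplit : ∀ x : W.InterpSpace p, ‖x‖ ^ p = ∑ n ∈ Finset.range N,
      W.levelNorm (n + 1) (incl x) ^ p + ∑' n, W.levelNorm (n + N + 1) (incl x) ^ p := fun x => by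
    rw [norm_rpow, ← (summable x).sum_add_tsum_nat_add N]
  have hhead_nonneg : ∀ x : W.InterpSpace p,
      0 ≤ ∑ n ∈ Finset.range N, W.levelNorm (n + 1) (incl x) ^ p := fun x =>
    Finset.sum_nonneg fun n _ => term_nonneg x n
  have htail_nonneg : ∀ x : W.InterpSpace p,
      0 ≤ ∑' n, W.levelNorm (n + N + 1) (incl x) ^ p := fun x =>
    tsum_nonneg fun n => term_nonneg x (n + N)
  have hhead : Tendsto (fun k => ∑ n ∈ Finset.range N, W.levelNorm (n + 1) (incl (u + z k)) ^ p)
      atTop (𝓝 (∑ n ∈ Finset.range N, W.levelNorm (n + 1) (incl u) ^ p)) := by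
    refine tendsto_finsetSum _ fun n _ => Tendsto.rpow_const ?_ (Or.inr hpos.le)
    refine ((W.continuous_levelNorm (n + 1)).tendsto _).comp ?_
    simpa using hz.const_add (incl u)
  obtain ⟨k, hk⟩ := (hhead.eventually_lt_const (lt_add_of_pos_right _ one_half_pos)).exists
  refine ⟨k, ?_⟩
  have htail : ∑' n, W.levelNorm (n + N + 1) (incl (u + z k)) ^ p ≤ (ε + R) ^ p := by
    have hmink := Real.Lp_add_le_tsum_of_nonneg hp.out.le
      (fun n => W.levelNorm_nonneg (n + N + 1) (incl u))
      (fun n => W.levelNorm_nonneg (n + N + 1) (incl (z k))) (hshift u) (hshift (z k))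
    have h1 : ∑' n, W.levelNorm (n + N + 1) (incl (u + z k)) ^ p ≤
        ∑' n, (W.levelNorm (n + N + 1) (incl u) + W.levelNorm (n + N + 1) (incl (z k))) ^ p := by
      refine (hshift _).tsum_le_tsum (fun n => ?_) hmink.1
      rw [map_add]
      exact Real.rpow_le_rpow (W.levelNorm_nonneg _ _) (W.levelNorm_add_le _ _ _) hpos.le
    have h2 : (∑' n, W.levelNorm (n + N + 1) (incl u) ^ p) ^ (1 / p) ≤ ε := by
      rw [one_div, Real.rpow_inv_le_iff_of_pos (htail_nonneg u) hε.le hpos]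
      exact hN.le
    have h3 : (∑' n, W.levelNorm (n + N + 1) (incl (z k)) ^ p) ^ (1 / p) ≤ R := by
      rw [one_div, Real.rpow_inv_le_iff_of_pos (htail_nonneg _) hR0 hpos]
      refine le_trans ?_ (Real.rpow_le_rpow (norm_nonneg _) (hR k) hpos.le)
      rw [hsplit (z k)]
      linarith [hhead_nonneg (z k)]
    have h4 := hmink.2.trans (add_le_add h2 h3)
    rw [one_div, Real.rpow_inv_le_iff_of_pos ((htail_nonneg _).trans h1) (by positivity) hpos] at h4
    exact h1.trans h4
  rw [hsplit (u + z k), hsplit u]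
  linarith [htail_nonneg u]

/-- A functional bounded below by `δ > 0` along a bounded sequence of `Δ_p(W, X)` that tends to `0`
in `X` would make sums of `m` terms of norm `≳ m`, while the gliding hump gives sums of
norm `≲ m^(1/p)`. -/
theorem exists_lt_of_tendsto_incl_zero {R : ℝ} {z : ℕ → W.InterpSpace p} (hR : ∀ k, ‖z k‖ ≤ R)
    (hz : Tendsto (fun k => incl (z k)) atTop (𝓝 0)) (f : StrongDual ℝ (W.InterpSpace p))
    {δ : ℝ} (hδ : 0 < δ) : ∃ k, f (z k) < δ := by
  by_contra! hf
  have hpos := p_pos p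
  have hR0 : 0 ≤ R := (norm_nonneg _).trans (hR 0)
  have hsums : ∀ m : ℕ, ∃ S : W.InterpSpace p, ‖S‖ ^ p ≤ m * (R ^ p + 1) ∧ m * δ ≤ f S := by
    intro m
    induction m with
    | zero => exact ⟨0, by simp [Real.zero_rpow hpos.ne'], by simp⟩
    | succ m ih =>
      obtain ⟨S, hS, hS'⟩ := ih
      obtain ⟨k, hk⟩ := exists_norm_add_rpow_le hR hz S
      refine ⟨S + z k, ?_, ?_⟩
      · push_cast; linarith
      · rw [map_add]; push_cast; linarith [hf k]
  have hbound : ∀ m : ℕ, 0 < m → (m : ℝ) ^ (p - 1) ≤ ‖f‖ ^ p * (R ^ p + 1) / δ ^ p := by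
    intro m hm
    obtain ⟨S, hS, hS'⟩ := hsums m
    have hm' : (0 : ℝ) < m := by exact_mod_cast hm
    have h1 : (m * δ) ^ p ≤ (‖f‖ * ‖S‖) ^ p :=
      Real.rpow_le_rpow (by positivity) (hS'.trans ((le_abs_self _).trans (f.le_opNorm S))) hpos.le
    rw [Real.mul_rpow hm'.le hδ.le, Real.mul_rpow (norm_nonneg _) (norm_nonneg _)] at h1
    have h2 : (m : ℝ) ^ p * δ ^ p ≤ ‖f‖ ^ p * (m * (R ^ p + 1)) :=
      h1.trans (mul_le_mul_of_nonneg_left hS (by positivity))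
    rw [le_div_iff₀ (by positivity), Real.rpow_sub_one hm'.ne', div_mul_eq_mul_div,
      div_le_iff₀ hm']
    linarith
  have hlim : Tendsto (fun m : ℕ => (m : ℝ) ^ (p - 1)) atTop atTop :=
    (tendsto_rpow_atTop (by linarith [hp.out])).comp tendsto_natCast_atTop_atTop
  obtain ⟨m, hm, hm'⟩ := ((hlim.eventually_gt_atTop (‖f‖ ^ p * (R ^ p + 1) / δ ^ p)).and
    (eventually_gt_atTop 0)).exists
  exact absurd (hbound m hm') hm.not_ge

/-- On bounded subsets of `Δ_p(W, X)` the weak topology is the one induced by the weak topology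
of `X`. -/
theorem weakTendsto_of_incl {ι : Type*} {l : Filter ι} {y : ι → W.InterpSpace p}
    {x : W.InterpSpace p} {R : ℝ} (hR : ∀ᶠ i in l, ‖y i‖ ≤ R)
    (h : WeakTendsto (fun i => incl (y i)) l (incl x)) : WeakTendsto y l x := by
  have key : ∀ (f : StrongDual ℝ (W.InterpSpace p)), ∀ ε > 0, ∀ᶠ i in l, f (y i - x) < ε := by
    intro f ε hε
    by_contra hcon
    -- Mazur: the slice where `f ≥ ε` contains vectors of arbitrarily small norm in `X`
    let C : Set (W.InterpSpace p) := {z | ε ≤ f z} ∩ Metric.closedBall 0 (R + ‖x‖)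
    have hC : Convex ℝ C :=
      (convex_halfSpace_ge f.toLinearMap.isLinear ε).inter (convex_closedBall _ _)
    have h0 : (0 : X) ∈ closure (incl '' C) := by
      have hlim : WeakTendsto (fun i => incl (y i) - incl x) l 0 := by
        simpa using h.sub (g' := fun _ => incl x) (fun f => tendsto_const_nhds)
      refine hlim.mem_of_frequently (hC.linear_image _).closure isClosed_closure ?_
      refine ((not_eventually.1 hcon).and_eventually hR).mono fun i hi => subset_closure ?_
      refine ⟨y i - x, ⟨not_lt.1 hi.1, ?_⟩, map_sub _ _ _⟩
      rw [mem_closedBall_zero_iff]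
      exact (norm_sub_le _ _).trans (by linarith [hi.2])
    obtain ⟨s, hs, hs0⟩ := mem_closure_iff_seq_limit.1 h0
    choose z hz hzs using hs
    obtain ⟨k, hk⟩ := exists_lt_of_tendsto_incl_zero (z := z)
      (fun k => mem_closedBall_zero_iff.1 (hz k).2) (by simpa [hzs] using hs0) f hε
    exact absurd hk (not_lt.2 (hz k).1)
  intro f
  rw [Metric.tendsto_nhds]
  intro ε hε
  filter_upwards [key f ε hε, key (-f) ε hε] with i h1 h2
  rw [Real.dist_eq, abs_lt]
  simp only [map_sub, neg_apply] at h1 h2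
  constructor <;> linarith

/-- The balls of `Δ_p(W, X)` are closed in `X`. -/
theorem exists_incl_eq_of_mem_closure {R : ℝ} {x : X}
    (hx : x ∈ closure (incl '' Metric.closedBall (0 : W.InterpSpace p) R)) :
    ∃ y : W.InterpSpace p, incl y = x := by
  have hpos := p_pos p
  obtain ⟨s, hs, hsx⟩ := mem_closure_iff_seq_limit.1 hx
  choose z hz hzs using hs
  have hsum : Summable fun n : ℕ => W.levelNorm (n + 1) x ^ p := by
    refine summable_of_sum_range_le (c := R ^ p)
      (fun n => Real.rpow_nonneg (W.levelNorm_nonneg _ _) _) fun N => ?_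
    have hlim : Tendsto (fun k => ∑ n ∈ Finset.range N, W.levelNorm (n + 1) (s k) ^ p) atTop
        (𝓝 (∑ n ∈ Finset.range N, W.levelNorm (n + 1) x ^ p)) :=
      tendsto_finsetSum _ fun n _ =>
        (((W.continuous_levelNorm (n + 1)).tendsto _).comp hsx).rpow_const (Or.inr hpos.le)
    refine le_of_tendsto' hlim fun k => ?_
    rw [← hzs]
    refine ((summable (z k)).sum_le_tsum _ fun n _ => term_nonneg _ n).trans ?_
    rw [← norm_rpow]
    exact Real.rpow_le_rpow (norm_nonneg _) (mem_closedBall_zero_iff.1 (hz k)) hpos.le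
  exact ⟨⟨x, hsum⟩, rfl⟩

/-- The Davis–Figiel–Johnson–Pełczyński theorem: if `W` is relatively weakly compact, then
`Δ_p(W, X)` is reflexive. -/
theorem isReflexiveSpace [CompleteSpace X]
    (hW : ∀ (ι : Type u) (U : Ultrafilter ι) (w : ι → X), (∀ i, w i ∈ W.carrier) →
      ∃ x, WeakTendsto w U x) :
    IsReflexiveSpace (W.InterpSpace p) := by
  intro Φ
  obtain ⟨U, hU, hΦ⟩ := exists_ultrafilter_tendsto_bidual Φ
  set R : ℝ := ‖Φ‖ + 1
  have hR : 0 < R + 1 := by positivity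
  -- a ball of the interpolation space is within `2⁻ⁿ (R + 1)` of a multiple of `W`, for every `n`
  have happrox : ∃ x, WeakTendsto (fun y : W.InterpSpace p => incl y) U x := by
    refine exists_weakTendsto_of_approx _ fun ε hε => ?_
    obtain ⟨n, hn⟩ : ∃ n : ℕ, (R + 1) * ((2 : ℝ) ^ (n + 1))⁻¹ < ε := by
      have h1 : Tendsto (fun n : ℕ => (R + 1) * ((2 : ℝ)⁻¹ ^ (n + 1))) atTop (𝓝 0) := by
        simpa using ((tendsto_pow_atTop_nhds_zero_of_lt_one (r := (2 : ℝ)⁻¹) (by norm_num)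
          (by norm_num)).comp (tendsto_add_atTop_nat 1)).const_mul (R + 1)
      simpa using (h1.eventually_lt_const hε).exists
    have hdec : ∀ y : W.InterpSpace p, ∃ w ∈ W.carrier, ‖y‖ ≤ R →
        ‖incl y - (R + 1) • (2 : ℝ) ^ (n + 1) • w‖ ≤ ε := by
      intro y
      by_cases hy : ‖y‖ ≤ R
      · have hlt : gauge (W.levelSet (n + 1)) ((R + 1)⁻¹ • incl y) < 1 := by
          rw [gauge_smul_of_nonneg (by positivity), smul_eq_mul, inv_mul_lt_iff₀ hR, mul_one]
          exact ((levelNorm_le_norm y n).trans hy).trans_lt (lt_add_one R)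
        have h0 : (0 : X) ∈ W.levelSet (n + 1) := mem_of_mem_nhds (W.levelSet_mem_nhds _)
        obtain ⟨_, ⟨w, hw, rfl⟩, _, ⟨b, hb, rfl⟩, e⟩ :=
          setOfPred_gauge_lt_one_subset_self (W.levelSet_convex _) h0 (W.levelSet_absorbent _) hlt
        refine ⟨w, hw, fun _ => ?_⟩
        have e' : incl y = (R + 1) • ((2 : ℝ) ^ (n + 1) • w + ((2 : ℝ) ^ (n + 1))⁻¹ • b) :=
          (inv_smul_eq_iff₀ hR.ne').1 e.symm
        rw [e', smul_add, add_sub_cancel_left, norm_smul, norm_smul, Real.norm_of_nonneg hR.le,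
          Real.norm_of_nonneg (by positivity)]
        refine le_trans ?_ hn.le
        have hb1 : ‖b‖ ≤ 1 := mem_closedBall_zero_iff.1 hb
        have : ((2 : ℝ) ^ (n + 1))⁻¹ * ‖b‖ ≤ ((2 : ℝ) ^ (n + 1))⁻¹ :=
          mul_le_of_le_one_right (by positivity) hb1
        exact mul_le_mul_of_nonneg_left this hR.le
      · exact ⟨0, W.zero_mem, fun h => absurd h hy⟩
    choose w hw hw' using hdec
    obtain ⟨x, hx⟩ := hW _ U w hw
    exact ⟨_, _, hU.mono hw', (hx.const_smul _).const_smul _⟩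
  obtain ⟨x, hx⟩ := happrox
  obtain ⟨y, rfl⟩ : ∃ y : W.InterpSpace p, incl y = x := by
    have hmem : ∀ᶠ y in (U : Filter (W.InterpSpace p)),
        incl y ∈ closure (incl '' Metric.closedBall (0 : W.InterpSpace p) R) :=
      hU.mono fun y hy => subset_closure ⟨y, mem_closedBall_zero_iff.2 hy, rfl⟩
    exact exists_incl_eq_of_mem_closure (hx.mem_of_frequently
      ((convex_closedBall _ _).linear_image _).closure isClosed_closure hmem.frequently)
  have hy : WeakTendsto (fun y : W.InterpSpace p => y) U y := weakTendsto_of_incl hU hx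
  refine ⟨y, ContinuousLinearMap.ext fun f => ?_⟩
  rw [NormedSpace.dual_def]
  exact tendsto_nhds_unique (hy f) (hΦ f)

end InterpSpace

end ConvexSymmetricBody

/-! ### Closed absolutely convex hulls of weakly null families -/

section Hull

variable {I X : Type*} [NormedAddCommGroup X] [NormedSpace ℝ X]

theorem exists_linearCombination_of_mem_absConvexHull {u : I → X} {x : X}
    (hx : x ∈ absConvexHull ℝ (range u)) :
    ∃ a : I →₀ ℝ, (∀ s : Finset I, ∑ i ∈ s, |a i| ≤ 1) ∧ Finsupp.linearCombination ℝ u a = x := by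
  classical
  let A : Set (I →₀ ℝ) := {a | ∀ s : Finset I, ∑ i ∈ s, |a i| ≤ 1}
  suffices h : absConvexHull ℝ (range u) ⊆ Finsupp.linearCombination ℝ u '' A by
    obtain ⟨a, ha, e⟩ := h hx
    exact ⟨a, ha, e⟩
  have hconv : Convex ℝ A := by
    intro a ha b hb c d hc hd hcd s
    calc ∑ i ∈ s, |(c • a + d • b) i| ≤ ∑ i ∈ s, (c * |a i| + d * |b i|) := by
          refine Finset.sum_le_sum fun i _ => ?_
          simpa [abs_mul, abs_of_nonneg hc, abs_of_nonneg hd] using abs_add_le (c * a i) (d * b i)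
      _ = c * ∑ i ∈ s, |a i| + d * ∑ i ∈ s, |b i| := by
          rw [Finset.sum_add_distrib, Finset.mul_sum, Finset.mul_sum]
      _ ≤ c * 1 + d * 1 := add_le_add (mul_le_mul_of_nonneg_left (ha s) hc)
          (mul_le_mul_of_nonneg_left (hb s) hd)
      _ = 1 := by linarith
  have hbal : Balanced ℝ A := by
    rintro c hc _ ⟨a, ha, rfl⟩ s
    have h : ∑ i ∈ s, |(c • a) i| = |c| * ∑ i ∈ s, |a i| := by
      rw [Finset.mul_sum]
      exact Finset.sum_congr rfl fun i _ => by simp [abs_mul]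
    exact h.trans_le (mul_le_one₀ hc (Finset.sum_nonneg fun i _ => abs_nonneg _) (ha s))
  refine absConvexHull_min ?_ ⟨?_, hconv.linear_image _⟩
  · rintro _ ⟨i, rfl⟩
    refine ⟨Finsupp.single i 1, fun s => ?_, by simp⟩
    have h : ∀ j ∈ s, |(Finsupp.single i (1 : ℝ)) j| = if i = j then 1 else 0 := by
      intro j _
      rw [Finsupp.single_apply]
      split_ifs <;> simp
    rw [Finset.sum_congr rfl h, Finset.sum_ite_eq]
    split_ifs <;> norm_num
  · rintro c hc _ ⟨_, ⟨a, ha, rfl⟩, rfl⟩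
    exact ⟨c • a, hbal c hc ⟨a, ha, rfl⟩, map_smul _ _ _⟩

/-- A case of Krein's theorem: the coefficients in the unit ball of `ℓ₁` have coordinatewise
limits along an ultrafilter, and these are weak limits because the functionals on the family are
in `c₀`. -/
theorem exists_weakTendsto_of_mem_closedAbsConvexHull [CompleteSpace X] {u : I → X} {B : ℝ}
    (hB : ∀ i, ‖u i‖ ≤ B)
    (hu : ∀ f : StrongDual ℝ X, Tendsto (fun i => f (u i)) cofinite (𝓝 0))
    {ι : Type*} (U : Ultrafilter ι) (w : ι → X)
    (hw : ∀ j, w j ∈ closedAbsConvexHull ℝ (range u)) : ∃ x, WeakTendsto w U x := by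
  refine exists_weakTendsto_of_approx w fun ε hε => ?_
  have happ : ∀ j, ∃ a : I →₀ ℝ, (∀ s : Finset I, ∑ i ∈ s, |a i| ≤ 1) ∧
      ‖w j - Finsupp.linearCombination ℝ u a‖ ≤ ε := by
    intro j
    have h := hw j
    rw [closedAbsConvexHull_eq_closure_absConvexHull] at h
    obtain ⟨v, hv, hd⟩ := Metric.mem_closure_iff.1 h ε hε
    obtain ⟨a, ha, rfl⟩ := exists_linearCombination_of_mem_absConvexHull hv
    exact ⟨a, ha, by rw [← dist_eq_norm]; exact hd.le⟩
  choose a ha ha' using happ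
  have hlim : ∀ i, ∃ α : ℝ, Tendsto (fun j => a j i) U (𝓝 α) := by
    intro i
    obtain ⟨α, -, h⟩ := isCompact_Icc.ultrafilter_le_nhds (U.map fun j => a j i)
      (le_principal_iff.2 (Eventually.of_forall fun j => by
        simpa [abs_le] using ha j {i} : ∀ᶠ j in (U : Filter ι), a j i ∈ Icc (-1 : ℝ) 1))
    exact ⟨α, h⟩
  choose α hα using hlim
  have hα1 : ∀ s : Finset I, ∑ i ∈ s, |α i| ≤ 1 := fun s =>
    le_of_tendsto (tendsto_finsetSum s fun i _ => (hα i).abs) (Eventually.of_forall fun j => ha j s)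
  have hαs : Summable fun i => |α i| := summable_of_sum_le (fun i => abs_nonneg _) hα1
  have hsum : Summable fun i => α i • u i := by
    refine Summable.of_norm_bounded (hαs.mul_right B) fun i => ?_
    rw [norm_smul]
    exact mul_le_mul_of_nonneg_left (hB i) (norm_nonneg _)
  refine ⟨fun j => Finsupp.linearCombination ℝ u (a j), ∑' i, α i • u i,
    Eventually.of_forall ha', fun f => ?_⟩
  have hfx : HasSum (fun i => α i * f (u i)) (f (∑' i, α i • u i)) := by
    simpa [Function.comp_def] using f.hasSum hsum.hasSum
  have hfa : ∀ j, HasSum (fun i => a j i * f (u i)) (f (Finsupp.linearCombination ℝ u (a j))) := by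
    intro j
    have h : f (Finsupp.linearCombination ℝ u (a j)) = ∑ i ∈ (a j).support, a j i * f (u i) := by
      simp [Finsupp.linearCombination_apply, Finsupp.sum]
    rw [h]
    exact hasSum_sum_of_ne_finset_zero fun i hi => by simp [Finsupp.notMem_support_iff.1 hi]
  rw [Metric.tendsto_nhds]
  intro η hη
  -- outside the finite set `s` the functional is small on the family
  have hfin : {i | ¬ |f (u i)| < η / 4}.Finite := by
    have := (Metric.tendsto_nhds.1 (hu f)) (η / 4) (by positivity)
    simpa [Real.dist_eq] using this
  set s := hfin.toFinset
  have hs : ∀ i ∉ s, |f (u i)| ≤ η / 4 := fun i hi => by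
    have : |f (u i)| < η / 4 := by simpa [s] using hi
    exact this.le
  have hhead : Tendsto (fun j => ∑ i ∈ s, |a j i - α i| * |f (u i)|) U (𝓝 0) := by
    have : Tendsto (fun j => ∑ i ∈ s, |a j i - α i| * |f (u i)|) U
        (𝓝 (∑ i ∈ s, |α i - α i| * |f (u i)|)) :=
      tendsto_finsetSum s fun i _ => (((hα i).sub_const _).abs).mul_const _
    simpa using this
  filter_upwards [hhead.eventually_lt_const (show (0 : ℝ) < η / 4 by positivity)] with j hj
  have hsub := (hfa j).sub hfx
  rw [Real.dist_eq]
  have hbound : |f (Finsupp.linearCombination ℝ u (a j)) - f (∑' i, α i • u i)| ≤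
      η / 4 + η / 4 * 2 := by
    refine le_of_tendsto hsub.abs ?_
    classical
    filter_upwards [eventually_ge_atTop s] with t ht
    rw [← Finset.sum_sdiff ht]
    have h2 : ∀ r : Finset I, ∑ i ∈ r, |a j i - α i| ≤ 2 := fun r => by
      calc ∑ i ∈ r, |a j i - α i| ≤ ∑ i ∈ r, (|a j i| + |α i|) :=
            Finset.sum_le_sum fun i _ => abs_sub _ _
        _ = ∑ i ∈ r, |a j i| + ∑ i ∈ r, |α i| := Finset.sum_add_distrib
        _ ≤ 2 := by linarith [ha j r, hα1 r]
    have e : ∀ i, a j i * f (u i) - α i * f (u i) = (a j i - α i) * f (u i) := fun i => by ring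
    simp only [e]
    have h3 : |∑ i ∈ t \ s, (a j i - α i) * f (u i)| ≤ η / 4 * 2 := by
      calc _ ≤ ∑ i ∈ t \ s, |(a j i - α i) * f (u i)| := Finset.abs_sum_le_sum_abs _ _
        _ ≤ ∑ i ∈ t \ s, η / 4 * |a j i - α i| := by
            refine Finset.sum_le_sum fun i hi => ?_
            rw [abs_mul, mul_comm]
            exact mul_le_mul_of_nonneg_right (hs i (Finset.mem_sdiff.1 hi).2) (abs_nonneg _)
        _ ≤ η / 4 * 2 := by
            rw [← Finset.mul_sum]
            exact mul_le_mul_of_nonneg_left (h2 _) (by positivity)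
    have h4 : |∑ i ∈ s, (a j i - α i) * f (u i)| ≤ η / 4 := by
      refine (Finset.abs_sum_le_sum_abs _ _).trans ?_
      simp only [abs_mul]
      exact hj.le
    exact (abs_add_le _ _).trans (by linarith)
  linarith

end Hull

/-! ### Families whose sequences have null averages -/

section NullAverages

universe u v

variable {I : Type v} {E : Type u} [NormedAddCommGroup E] [NormedSpace ℝ E]

/-- Every sequence of distinct members of the family `u` has a subsequence whose averages
converge to `0` in norm. -/
def HasNullAverages (u : I → E) : Prop :=
  ∀ φ : ℕ → I, Function.Injective φ → ∃ ψ : ℕ → ℕ, StrictMono ψ ∧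
    Tendsto (fun n : ℕ => (n : ℝ)⁻¹ • ∑ k ∈ Finset.range n, u (φ (ψ k))) atTop (𝓝 0)

theorem HasNullAverages.tendsto_cofinite {u : I → E} (h : HasNullAverages u)
    (f : StrongDual ℝ E) : Tendsto (fun i => f (u i)) cofinite (𝓝 0) := by
  have key : ∀ (f : StrongDual ℝ E), ∀ ε > 0, ∀ᶠ i in cofinite, f (u i) < ε := by
    intro f ε hε
    by_contra hcon
    have hinf : {i | ¬ f (u i) < ε}.Infinite := hcon
    let φ := hinf.natEmbedding
    obtain ⟨ψ, -, hψ⟩ := h (fun k => φ k) (Subtype.val_injective.comp φ.injective)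
    have h1 := (f.continuous.tendsto 0).comp hψ
    rw [map_zero] at h1
    obtain ⟨n, hn, hn'⟩ := ((h1.eventually_lt_const hε).and (eventually_gt_atTop 0)).exists
    have hn0 : (0 : ℝ) < n := by exact_mod_cast hn'
    rw [Function.comp_apply, map_smul, map_sum, smul_eq_mul, inv_mul_lt_iff₀ hn0] at hn
    have h2 : ∑ _k ∈ Finset.range n, ε ≤ ∑ k ∈ Finset.range n, f (u (φ (ψ k))) :=
      Finset.sum_le_sum fun k _ => not_lt.1 (φ (ψ k)).2
    rw [Finset.sum_const, Finset.card_range, nsmul_eq_mul] at h2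
    linarith
  rw [Metric.tendsto_nhds]
  intro ε hε
  filter_upwards [key f ε hε, key (-f) ε hε] with i h1 h2
  rw [Real.dist_eq, sub_zero, abs_lt]
  simp only [neg_apply] at h2
  constructor <;> linarith

theorem exists_strictMono_injective_comp {α : Type*} {g : ℕ → α} {K : Set α} (hK : K.Infinite)
    (hKg : K ⊆ range g) :
    ∃ φ : ℕ → ℕ, StrictMono φ ∧ Function.Injective (g ∘ φ) ∧ ∀ n, g (φ n) ∈ K := by
  classical
  -- the indices at which a member of `K` occurs for the first time
  let A : Set ℕ := {m | g m ∈ K ∧ ∀ m' < m, g m' ≠ g m}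
  have hA : A.Infinite := by
    refine fun hfin => hK ((hfin.image g).subset fun x hx => ?_)
    have hex : ∃ m, g m = x := hKg hx
    refine ⟨Nat.find hex, ⟨?_, fun m' hm' => ?_⟩, Nat.find_spec hex⟩
    · rw [Nat.find_spec hex]; exact hx
    · rw [Nat.find_spec hex]; exact Nat.find_min hex hm'
  have hmem : ∀ n, Nat.nth (· ∈ A) n ∈ A := Nat.nth_mem_of_infinite hA
  have hmono : StrictMono (Nat.nth (· ∈ A)) := Nat.nth_strictMono hA
  refine ⟨Nat.nth (· ∈ A), hmono, fun a b hab => ?_, fun n => (hmem n).1⟩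
  rcases lt_trichotomy a b with h | h | h
  · exact absurd hab ((hmem b).2 _ (hmono h))
  · exact h
  · exact absurd hab.symm ((hmem a).2 _ (hmono h))

theorem HasNullAverages.isBanachSaksSet_range {u : I → E} (h : HasNullAverages u) :
    IsBanachSaksSet (range u) := by
  intro x hx
  choose g hg using hx
  by_cases hfin : (range g).Finite
  · -- a sequence with finitely many values has a constant subsequence
    have : Finite (range g) := hfin
    obtain ⟨i, hi⟩ := Finite.exists_infinite_fiber (rangeFactorization g)
    have hA : (rangeFactorization g ⁻¹' {i}).Infinite := infinite_coe_iff.1 hi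
    obtain ⟨θ, hθ, hmem⟩ : ∃ θ : ℕ → ℕ, StrictMono θ ∧ ∀ n, g (θ n) = i :=
      ⟨_, Nat.nth_strictMono hA, fun n => congrArg Subtype.val (Nat.nth_mem_of_infinite hA n)⟩
    refine ⟨θ, hθ, u i, tendsto_const_nhds.congr' ?_⟩
    filter_upwards [eventually_gt_atTop 0] with n hn
    have hn0 : (n : ℝ) ≠ 0 := by exact_mod_cast hn.ne'
    simp only [← hg, hmem, Finset.sum_const, Finset.card_range]
    rw [← Nat.cast_smul_eq_nsmul ℝ, inv_smul_smul₀ hn0]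
  · obtain ⟨φ, hφ, hinj, -⟩ := exists_strictMono_injective_comp hfin subset_rfl
    obtain ⟨ψ, hψ, hlim⟩ := h _ hinj
    refine ⟨φ ∘ ψ, hφ.comp hψ, 0, ?_⟩
    simpa [hg] using hlim

end NullAverages

/-! ### The unit basis of the Schreier-like space and its lift to the interpolation space -/

universe u

theorem SchreierPre.coord_sum {I : Type u} {F : Set (Finset I)} {ι : Type*} (t : Finset ι)
    (x : ι → SchreierPre F) (i : I) : (∑ k ∈ t, x k).coord i = ∑ k ∈ t, (x k).coord i := by
  classical
  induction t using Finset.induction_on with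
  | empty => simp [SchreierPre.coord_zero]
  | insert a t ha ih => rw [Finset.sum_insert ha, Finset.sum_insert ha, coord_add, ih]

theorem SchreierSpace.coe_sum {I : Type u} {F : Set (Finset I)} {ι : Type*} (t : Finset ι)
    (x : ι → SchreierPre F) :
    ((∑ k ∈ t, x k : SchreierPre F) : SchreierSpace F) = ∑ k ∈ t, (x k : SchreierSpace F) :=
  map_sum (UniformSpace.Completion.toComplL (𝕜 := ℝ) (E := SchreierPre F)) _ _

theorem SchreierPre.coord_sum_unit {I : Type u} [DecidableEq I] (F : Set (Finset I))
    (t : Finset I) (i : I) :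
    (∑ j ∈ t, SchreierPre.unit F j).coord i = if i ∈ t then 1 else 0 := by
  rw [coord_sum, ← Finset.sum_ite_eq t i fun _ => (1 : ℝ)]
  refine Finset.sum_congr rfl fun j _ => ?_
  split_ifs with h
  · rw [h, coord_unit_self]
  · exact coord_unit_of_ne h

/-- If every member of `F` meets `t` in at most `n` points, the sum of the unit vectors over `t` has
norm at most `n + 1`. -/
theorem SchreierPre.norm_sum_unit_le {I : Type u} [DecidableEq I] {F : Set (Finset I)}
    {t : Finset I} {n : ℕ} (h : ∀ s ∈ F, (s ∩ t).card ≤ n) :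
    ‖∑ j ∈ t, SchreierPre.unit F j‖ ≤ n + 1 := by
  refine norm_le_of (by positivity) (fun i => ?_) fun s hs => ?_
  · rw [coord_sum_unit]
    have : (0 : ℝ) ≤ n := n.cast_nonneg
    split_ifs
    · simp
    · simpa using by linarith
  · have e : ∀ i ∈ s, |(∑ j ∈ t, SchreierPre.unit F j).coord i| = if i ∈ t then 1 else 0 := by
      intro i _
      rw [coord_sum_unit]
      split_ifs <;> simp
    rw [Finset.sum_congr rfl e, Finset.sum_boole, Finset.filter_mem_eq_inter]
    have : ((s ∩ t).card : ℝ) ≤ n := by exact_mod_cast h s hs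
    linarith

theorem SchreierSpace.hasNullAverages_basisVec {I : Type u} {F : Set (Finset I)}
    (hF : ∀ J : Set I, J.Infinite → ¬ IsLargeIn F J) :
    HasNullAverages (SchreierSpace.basisVec F) := by
  classical
  intro φ hφ
  have hlarge := hF (range φ) (infinite_range_of_injective hφ)
  simp only [IsLargeIn, IsNLargeIn, not_forall, not_exists, not_and, not_le] at hlarge
  obtain ⟨n, K, hKφ, hK, hFK⟩ := hlarge
  obtain ⟨ψ, hψ, hinj, hmem⟩ := exists_strictMono_injective_comp hK hKφ
  refine ⟨ψ, hψ, squeeze_zero_norm (a := fun m : ℕ => ((n : ℝ) + 1) / m) (fun m => ?_)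
    (tendsto_const_div_atTop_nhds_zero_nat _)⟩
  have e : ∑ k ∈ Finset.range m, SchreierSpace.basisVec F (φ (ψ k)) =
      ((∑ j ∈ (Finset.range m).image (φ ∘ ψ), SchreierPre.unit F j : SchreierPre F) :
        SchreierSpace F) := by
    rw [Finset.sum_image fun a _ b _ h => hinj h]
    exact (coe_sum _ _).symm
  rw [e, norm_smul, UniformSpace.Completion.norm_coe, norm_inv, Real.norm_natCast, div_eq_inv_mul]
  refine mul_le_mul_of_nonneg_left (SchreierPre.norm_sum_unit_le fun s hs => ?_) (by positivity)
  refine le_trans ?_ (hFK s hs).le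
  rw [← ncard_coe_finset]
  refine ncard_le_ncard ?_ (s.finite_toSet.inter_of_left _)
  intro i hi
  rw [Finset.coe_inter] at hi
  obtain ⟨h1, h2⟩ := hi
  obtain ⟨k, -, rfl⟩ := Finset.mem_image.1 (Finset.mem_coe.1 h2)
  exact ⟨h1, hmem k⟩

section Lift

variable {I : Type u} [Nonempty I] {F : Set (Finset I)} {p : ℝ} [hp : Fact (1 < p)]

open ConvexSymmetricBody

theorem SchreierSpace.basisVec_mem_basisHull (i : I) :
    SchreierSpace.basisVec F i ∈ (SchreierSpace.basisHull F).carrier :=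
  subset_closedAbsConvexHull (mem_range_self i)

variable (F p) in
/-- The unit basis of `X_F`, which lies in the body `W`, seen in the interpolation space. -/
noncomputable def SchreierSpace.liftVec (i : I) : (SchreierSpace.basisHull F).InterpSpace p :=
  ⟨SchreierSpace.basisVec F i, InterpSpace.mem_interpSubmodule_of_mem p
    (SchreierSpace.basisVec_mem_basisHull i)⟩

theorem SchreierSpace.incl_liftVec (i : I) :
    InterpSpace.incl (SchreierSpace.liftVec F p i) = SchreierSpace.basisVec F i := rfl

theorem SchreierSpace.hasNullAverages_liftVec
    (hF : ∀ J : Set I, J.Infinite → ¬ IsLargeIn F J) :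
    HasNullAverages (SchreierSpace.liftVec F p) := by
  intro φ hφ
  obtain ⟨ψ, hψ, hlim⟩ := SchreierSpace.hasNullAverages_basisVec hF φ hφ
  refine ⟨ψ, hψ, InterpSpace.tendsto_zero_of_mem_of_incl (fun m => ?_) ?_⟩
  · rw [map_smul, map_sum]
    rcases Nat.eq_zero_or_pos m with rfl | hm
    · simpa using (SchreierSpace.basisHull F).zero_mem
    · rw [Finset.smul_sum]
      refine (SchreierSpace.basisHull F).convex.sum_mem (fun _ _ => by positivity) ?_
        fun k _ => SchreierSpace.basisVec_mem_basisHull _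
      have hm0 : (m : ℝ) ≠ 0 := by exact_mod_cast hm.ne'
      simp [hm0]
  · simpa [SchreierSpace.incl_liftVec] using hlim

theorem SchreierSpace.isReflexiveSpace_interpSpace
    (hF : ∀ J : Set I, J.Infinite → ¬ IsLargeIn F J) :
    IsReflexiveSpace ((SchreierSpace.basisHull F).InterpSpace p) :=
  InterpSpace.isReflexiveSpace fun _ U w hw =>
    exists_weakTendsto_of_mem_closedAbsConvexHull (u := SchreierSpace.basisVec F) (B := 1)
      (fun i => by simp [SchreierSpace.basisVec, UniformSpace.Completion.norm_coe,
        SchreierPre.norm_unit])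
      (SchreierSpace.hasNullAverages_basisVec hF).tendsto_cofinite U w hw

end Lift

/-! ### Block averages -/

section Blocks

variable {I : Type u}

/-- The average of the unit vectors over the finite set `A`. -/
noncomputable def SchreierPre.blockAverage (F : Set (Finset I)) (A : Finset I) : SchreierPre F :=
  (A.card : ℝ)⁻¹ • ∑ i ∈ A, SchreierPre.unit F i

theorem SchreierPre.coord_blockAverage [DecidableEq I] (F : Set (Finset I)) (A : Finset I) (i : I) :
    (blockAverage F A).coord i = (A.card : ℝ)⁻¹ * if i ∈ A then 1 else 0 := by
  rw [blockAverage, coord_smul, coord_sum_unit]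

theorem SchreierPre.coord_blockAverage_nonneg (F : Set (Finset I)) (A : Finset I) (i : I) :
    0 ≤ (blockAverage F A).coord i := by
  classical
  rw [coord_blockAverage]
  split_ifs <;> simp

/-- A member of `F` that fills at least the proportion `lam` of each of the blocks `A k`, `k ∈ t'`,
bounds the norm of the sum of the block averages from below. -/
theorem SchreierPre.le_norm_sum_blockAverage {F : Set (Finset I)} {s : Finset I} (hs : s ∈ F)
    {lam : ℝ} {A : ℕ → Finset I} {t t' : Finset ℕ} (htt' : t' ⊆ t) (hA : ∀ k ∈ t', (A k).Nonempty)
    (hlam : ∀ k ∈ t', lam * (A k).card ≤ (((s : Set I) ∩ (A k : Set I)).ncard : ℝ)) :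
    t'.card * lam ≤ ‖∑ k ∈ t, blockAverage F (A k)‖ := by
  classical
  calc (t'.card : ℝ) * lam = ∑ k ∈ t', lam := by rw [Finset.sum_const, nsmul_eq_mul]
    _ ≤ ∑ k ∈ t', ∑ i ∈ s, (blockAverage F (A k)).coord i := by
        refine Finset.sum_le_sum fun k hk => ?_
        simp only [coord_blockAverage]
        have hpos : (0 : ℝ) < (A k).card := by exact_mod_cast (hA k hk).card_pos
        rw [← Finset.mul_sum, Finset.sum_boole, Finset.filter_mem_eq_inter, ← div_eq_inv_mul,
          le_div_iff₀ hpos]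
        simpa only [← Finset.coe_inter, ncard_coe_finset] using hlam k hk
    _ ≤ ∑ k ∈ t, ∑ i ∈ s, (blockAverage F (A k)).coord i :=
        Finset.sum_le_sum_of_subset_of_nonneg htt' fun k _ _ =>
          Finset.sum_nonneg fun i _ => coord_blockAverage_nonneg F (A k) i
    _ = ∑ i ∈ s, (∑ k ∈ t, blockAverage F (A k)).coord i := by
        rw [Finset.sum_comm]
        exact Finset.sum_congr rfl fun i _ => (coord_sum t _ i).symm
    _ ≤ ∑ i ∈ s, |(∑ k ∈ t, blockAverage F (A k)).coord i| :=
        Finset.sum_le_sum fun i _ => le_abs_self _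
    _ ≤ _ := sum_le_norm _ hs

/-- Averages over disjoint blocks of a family that is null at a functional are null there. -/
theorem tendsto_blockAverage_zero {a : I → ℝ} (ha : Tendsto a cofinite (𝓝 0)) {P : ℕ → Finset I}
    (hne : ∀ n, (P n).Nonempty) (hP : ∀ m n, m ≠ n → Disjoint (P m) (P n)) :
    Tendsto (fun n => ((P n).card : ℝ)⁻¹ * ∑ i ∈ P n, a i) atTop (𝓝 0) := by
  rw [Metric.tendsto_nhds]
  intro ε hε
  have hfin : {i | ¬ |a i| < ε / 2}.Finite := by
    have := (Metric.tendsto_nhds.1 ha) (ε / 2) (half_pos hε)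
    simpa [Real.dist_eq] using this
  -- only finitely many blocks meet the finite exceptional set
  have hblocks : {n | ∃ i ∈ P n, ¬ |a i| < ε / 2}.Finite := by
    have hsub : ∀ n ∈ {n | ∃ i ∈ P n, ¬ |a i| < ε / 2}, ∃ i, i ∈ P n ∧ ¬ |a i| < ε / 2 :=
      fun n hn => hn
    have : Nonempty I := ⟨(hne 0).choose⟩
    choose! c hc hc' using hsub
    refine Finite.of_finite_image (f := c) (hfin.subset ?_) fun m hm n hn hmn => ?_
    · rintro _ ⟨n, hn, rfl⟩
      exact hc' n hn
    · by_contra h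
      exact Finset.disjoint_left.1 (hP m n h) (hc m hm) (hmn ▸ hc n hn)
  have hev : ∀ᶠ n in atTop, n ∉ {n | ∃ i ∈ P n, ¬ |a i| < ε / 2} := by
    rw [← Nat.cofinite_eq_atTop]
    exact hblocks.eventually_cofinite_notMem
  filter_upwards [hev] with n hn
  have hn' : ∀ i ∈ P n, |a i| ≤ ε / 2 := fun i hi => by
    by_contra h
    exact hn ⟨i, hi, fun h' => h h'.le⟩
  have hpos : (0 : ℝ) < (P n).card := by exact_mod_cast (hne n).card_pos
  rw [dist_zero_right, norm_mul, norm_inv, Real.norm_natCast, inv_mul_lt_iff₀ hpos]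
  calc ‖∑ i ∈ P n, a i‖ ≤ ∑ i ∈ P n, |a i| := norm_sum_le _ _
    _ ≤ (P n).card * (ε / 2) := by
        simpa [nsmul_eq_mul] using Finset.sum_le_sum hn'
    _ < (P n).card * ε := mul_lt_mul_of_pos_left (half_lt_self hε) hpos

variable [Nonempty I] {F : Set (Finset I)} {p : ℝ} [hp : Fact (1 < p)]

open ConvexSymmetricBody

/-- The block averages along a subsequence `N` on which the traces of `F` contain the Schreier
family have all their Cesàro means over `2 m` terms of norm at least `lam / 2`, while they are
weakly null. -/
theorem SchreierSpace.not_isBanachSaksSet_convexHull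
    (hF : ∀ J : Set I, J.Infinite → ¬ IsLargeIn F J) {P : ℕ → Finset I}
    (hP : IsFinitePartition P) {lam : ℝ} (hlam : 0 < lam)
    (hG : IsLargeIn (GFamily P lam F) univ) :
    ¬ IsBanachSaksSet (convexHull ℝ (range (SchreierSpace.liftVec F p))) := by
  intro hBS
  obtain ⟨N, hN, hsub⟩ := hG.exists_strictMono_subset
  let v : ℕ → (SchreierSpace.basisHull F).InterpSpace p := fun n =>
    ((P (N n)).card : ℝ)⁻¹ • ∑ i ∈ P (N n), SchreierSpace.liftVec F p i
  have hv : ∀ n, v n ∈ convexHull ℝ (range (SchreierSpace.liftVec F p)) := by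
    intro n
    have hpos : ((P (N n)).card : ℝ) ≠ 0 := by exact_mod_cast (hP.nonempty _).card_pos.ne'
    simp only [v, Finset.smul_sum]
    refine (convex_convexHull ℝ _).sum_mem (fun _ _ => by positivity) (by simp [hpos])
      fun i _ => subset_convexHull ℝ _ (mem_range_self i)
  have hincl : ∀ n, InterpSpace.incl (v n) =
      ((SchreierPre.blockAverage F (P (N n)) : SchreierPre F) : SchreierSpace F) := by
    intro n
    simp only [v, map_smul, map_sum, incl_liftVec, SchreierPre.blockAverage]
    rw [UniformSpace.Completion.coe_smul]
    congr 1
    exact (SchreierSpace.coe_sum _ _).symm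
  obtain ⟨φ, hφ, l, hl⟩ := hBS v hv
  have hl' := ((InterpSpace.inclL _ p).continuous.tendsto l).comp hl
  simp only [Function.comp_def, InterpSpace.inclL_apply, map_smul, map_sum] at hl'
  -- the limit is `0` because the block averages are weakly null
  have hl0 : InterpSpace.incl l = 0 := by
    refine SeparatingDual.eq_zero_of_forall_dual_eq_zero (R := ℝ) fun f => ?_
    have hf := tendsto_blockAverage_zero
      ((SchreierSpace.hasNullAverages_basisVec hF).tendsto_cofinite f) hP.nonempty hP.disjoint
    have hf' : Tendsto (fun k => f (InterpSpace.incl (v (φ k)))) atTop (𝓝 0) := by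
      refine (hf.comp (hN.comp hφ).tendsto_atTop).congr fun k => ?_
      simp [v, incl_liftVec]
    have h1 := (f.continuous.tendsto _).comp hl'
    refine tendsto_nhds_unique h1 (hf'.cesaro.congr fun n => ?_)
    simp
  rw [hl0] at hl'
  have hnorm := (tendsto_zero_iff_norm_tendsto_zero.1 hl').eventually_lt_const (half_pos hlam)
  obtain ⟨M, hM⟩ := eventually_atTop.1 hnorm
  set m := M + 1
  have hlt := hM (2 * m) (by omega)
  have hinj : Function.Injective (N ∘ φ) := (hN.comp hφ).injective
  obtain ⟨g, ⟨s, hs, hsg⟩, hg⟩ := hsub ((Finset.Ico m (2 * m)).image (N ∘ φ)) (by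
    intro i hi
    obtain ⟨k, hk, rfl⟩ := Finset.mem_image.1 hi
    rw [Finset.card_image_of_injective _ hinj, Nat.card_Ico]
    have := hφ.le_apply (x := k)
    rw [Finset.mem_Ico] at hk
    exact ⟨φ k, by omega, rfl⟩)
  have hlower := SchreierPre.le_norm_sum_blockAverage (A := fun k => P (N (φ k))) (lam := lam)
    (t := Finset.range (2 * m)) (t' := Finset.Ico m (2 * m)) hs
    (fun k hk => by rw [Finset.mem_Ico] at hk; simpa using hk.2) (fun k _ => hP.nonempty _)
    (fun k hk => (hsg _).1 (hg (Finset.mem_image_of_mem _ hk)))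
  have e : ∑ k ∈ Finset.range (2 * m), InterpSpace.incl (v (φ k)) =
      ((∑ k ∈ Finset.range (2 * m), SchreierPre.blockAverage F (P (N (φ k))) : SchreierPre F) :
        SchreierSpace F) := by
    simp only [hincl]
    exact (SchreierSpace.coe_sum _ _).symm
  have hm : (0 : ℝ) < (2 * m : ℕ) := by positivity
  rw [e, norm_smul, UniformSpace.Completion.norm_coe, norm_inv, Real.norm_natCast,
    inv_mul_lt_iff₀ hm] at hlt
  rw [Nat.card_Ico, show 2 * m - m = m by omega] at hlower
  push_cast at hlt
  linarith

end Blocks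

theorem mainTheorem7 {I : Type*} [Nonempty I] (F : Set (Finset I)) (hF : IsTFamily F)
    (p : ℝ) [Fact (1 < p)] :
    IsReflexiveSpace ((SchreierSpace.basisHull F).InterpSpace p) ∧
    ∃ y : ℕ → (SchreierSpace.basisHull F).InterpSpace p,
      IsWeaklyNull y ∧
      IsBanachSaksSet (Set.range y) ∧
      ¬ IsBanachSaksSet (convexHull ℝ (Set.range y)) := by
  obtain ⟨P, hP, hnot, lam, hlam, -, hG⟩ := hF.exists_partition
  refine ⟨SchreierSpace.isReflexiveSpace_interpSpace hnot, ?_⟩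
  -- the blocks show that `I` is countably infinite
  have hcount : Countable I := by
    rw [← countable_univ_iff]
    refine (countable_iUnion fun n => (P n).countable_toSet).mono fun i _ => ?_
    simpa using hP.cover i
  have hinf : Infinite I := by
    choose c hc using hP.nonempty
    refine Infinite.of_injective c fun m n hmn => ?_
    by_contra h
    exact Finset.disjoint_left.1 (hP.disjoint m n h) (hc m) (hmn ▸ hc n)
  obtain ⟨e⟩ := nonempty_equiv_of_countable (α := ℕ) (β := I)
  have hnull := SchreierSpace.hasNullAverages_liftVec (p := p) hnot
  have hrange : range (fun n => SchreierSpace.liftVec F p (e n)) =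
      range (SchreierSpace.liftVec F p) := 
    e.surjective.range_comp (SchreierSpace.liftVec F p)
  refine ⟨fun n => SchreierSpace.liftVec F p (e n), fun f => ?_, ?_, ?_⟩
  · rw [← Nat.cofinite_eq_atTop]
    exact (hnull.tendsto_cofinite f).comp e.injective.tendsto_cofinite
  · rw [hrange]
    exact hnull.isBanachSaksSet_range
  · rw [hrange]
    exact SchreierSpace.not_isBanachSaksSet_convexHull hnot hP hlam hG
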